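/- Let $d\ge 2$. For a finite collection $\mathcal B$ of $n$ closed balls of positive radius in $\mathbb R^d$ (repetitions allowed), let $G(\mathcal B)$ be its intersection graph: its vertices are the balls, and two of them are adjacent if they intersect. The ply $p(x)$ of a point $x$ is the number of balls in $\mathcal B$ that contain $x$, and the ply of $B\in\mathcal B$ is $p(B)=\max_{x\in B}p(x)$. A balanced separator of $G(\mathcal B)$ is a set $\mathcal X\subseteq\mathcal B$ such that each connected component of $G(\mathcal B)\setminus\mathcal X$ has at most $\tfrac23 n$ vertices. There are a randomized algorithm $A_d$ and constants $C_d,T_d$, depending only on $d$, such that for every $n$ and every collection $\mathcal B$ of $n$ balls in $\mathbb R^d$, given as a list of centers and radii, the algorithm $A_d$ on input $\mathcal B$ always halts after at most $T_d(n+1)$ steps, and with probability at least $\tfrac12$ its output is a balanced separator $\mathcal X$ of $G(\mathcal B)$ with \[|\mathcal X|\le C_d\Bigl(\sum_{B\in\mathcal B}p(B)^{\frac1{d-1}}\Bigr)^{1-\frac1d}.\] Here algorithms are programs of a randomized real RAM: it has registers and arrays of natural numbers and of real numbers; unit-cost instructions assign constants (natural or rational), copy, load and store, increase or decrease a natural number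 by one, apply $+,-,\times,\div$ to real numbers, draw a uniformly random natural number below a stored bound, and draw a uniformly random real number in $[0,1]$ (all draws being independent); branches and loops are controlled by unit-cost comparisons $<$ of two natural or of two real numbers. -/

import Mathlib

namespace BallSeparator

/-! ### Balls, ply, intersection graphs and balanced separators -/

/-- A closed ball of positive radius in `ℝ^d`, given by its center and its radius. -/
structure EuclideanBall (d : ℕ) where
  center : EuclideanSpace ℝ (Fin d)
  radius : ℝ
  radius_pos : 0 < radius

/-- The set of points of a ball. -/
def EuclideanBall.carrier {d : ℕ} (b : EuclideanBall d) : Set (EuclideanSpace ℝ (Fin d)) :=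
  Metric.closedBall b.center b.radius

/-- The ply of a point: the number of balls of the collection that contain it. -/
noncomputable def pointPly {d n : ℕ} (B : Fin n → EuclideanBall d)
    (x : EuclideanSpace ℝ (Fin d)) : ℕ :=
  {i : Fin n | x ∈ (B i).carrier}.ncard

/-- The ply of the `i`-th ball: the maximum ply of its points (a supremum of natural numbers that
are at most `n`, over a nonempty set). -/
noncomputable def ballPly {d n : ℕ} (B : Fin n → EuclideanBall d) (i : Fin n) : ℕ :=
  sSup (pointPly B '' (B i).carrier)

/-- The intersection graph of a collection of balls. -/
def intersectionGraph {d n : ℕ} (B : Fin n → EuclideanBall d) : SimpleGraph (Fin n) where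
  Adj i j := i ≠ j ∧ ((B i).carrier ∩ (B j).carrier).Nonempty
  symm := ⟨fun _ _ h => ⟨h.1.symm, by rw [Set.inter_comm]; exact h.2⟩⟩
  loopless := ⟨fun _ h => h.1 rfl⟩

/-- A vertex set `X` is a balanced separator of `G` if every connected component of `G ∖ X` has at
most `2/3` of the vertices of `G`. -/
def IsBalancedSeparator {V : Type*} (G : SimpleGraph V) (X : Set V) : Prop :=
  ∀ K : (G.induce Xᶜ).ConnectedComponent, (K.supp.ncard : ℝ) ≤ 2 / 3 * (Nat.card V : ℝ)

/-- The quantity `(∑_B p(B)^{1/(d-1)})^{1-1/d}`. -/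
noncomputable def separatorBound {d n : ℕ} (B : Fin n → EuclideanBall d) : ℝ :=
  (∑ i, (ballPly B i : ℝ) ^ (1 / ((d : ℝ) - 1))) ^ (1 - 1 / (d : ℝ))

/-! ### A randomized real RAM

A program is a finite text in a structured language. Its memory consists of scalar registers and of
arrays, for natural numbers (used as counters, flags and indices) and for real numbers. Every
instruction takes one unit of time, and so does every evaluation of a test.

Natural numbers can only be copied, increased or decreased by one, and drawn at random below a bound
stored in a register; hence they never exceed the input length plus the constants in the program
plus the running time. Real numbers cannot be rounded or otherwise converted to natural numbers. -/

/-- The memory. Registers and arrays are named by natural numbers; `natArr a i` and `realArr a i`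
are the `i`-th cells of the arrays `a`. The counter `drawn` is the number of random numbers that
have been used so far; programs have no access to it. -/
structure State where
  natReg : ℕ → ℕ
  realReg : ℕ → ℝ
  natArr : ℕ → ℕ → ℕ
  realArr : ℕ → ℕ → ℝ
  drawn : ℕ

/-- The elementary instructions. The first argument is the destination, except for the two `store`
instructions, whose arguments are the name of the array, the register that holds the index, and the
register that holds the value to be stored. In the `load` instructions the arguments are the
destination, the name of the array, and the register that holds the index. -/
inductive Instr where
  | natConst (dst c : ℕ)
  | natCopy (dst a : ℕ)
  | natSucc (dst a : ℕ)
  | natPred (dst a : ℕ)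
  | natLoad (dst arr idx : ℕ)
  | natStore (arr idx a : ℕ)
  | realConst (dst : ℕ) (q : ℚ)
  | realCopy (dst a : ℕ)
  | realAdd (dst a b : ℕ)
  | realSub (dst a b : ℕ)
  | realMul (dst a b : ℕ)
  | realDiv (dst a b : ℕ)
  | realLoad (dst arr idx : ℕ)
  | realStore (arr idx a : ℕ)
  /-- draw a uniformly random natural number below the content of the register `bound` -/
  | randIndex (dst bound : ℕ)
  /-- draw a uniformly random real number in `[0,1]` -/
  | randReal (dst : ℕ)

/-- The tests, comparing the contents of two registers. -/
inductive Test where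
  | natLt (a b : ℕ)
  | realLt (a b : ℕ)

/-- The programs; `loop b P` repeats `P` as long as the test `b` holds. -/
inductive Program where
  | skip
  | instr (c : Instr)
  | seq (P Q : Program)
  | ite (b : Test) (P Q : Program)
  | loop (b : Test) (P : Program)

/-- The source of randomness: a sequence of numbers in `[0,1]`. -/
abbrev RandomTape : Type := ℕ → unitInterval

/-- The law of the random tape: independent, uniformly distributed entries. -/
noncomputable def tapeMeasure : MeasureTheory.Measure RandomTape :=
  MeasureTheory.Measure.infinitePi
    (fun _ : ℕ => (MeasureTheory.volume : MeasureTheory.Measure unitInterval))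

namespace State

/-- Write a natural number to a register. -/
def setNat (s : State) (r v : ℕ) : State :=
  { s with natReg := Function.update s.natReg r v }

/-- Write a real number to a register. -/
noncomputable def setReal (s : State) (r : ℕ) (v : ℝ) : State :=
  { s with realReg := Function.update s.realReg r v }

/-- Write a natural number to the `i`-th cell of the array `arr`. -/
def setNatArr (s : State) (arr i v : ℕ) : State :=
  { s with natArr := Function.update s.natArr arr (Function.update (s.natArr arr) i v) }

/-- Write a real number to the `i`-th cell of the array `arr`. -/
noncomputable def setRealArr (s : State) (arr i : ℕ) (v : ℝ) : State :=
  { s with realArr := Function.update s.realArr arr (Function.update (s.realArr arr) i v) }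

/-- Mark the next random number as used. -/
def advance (s : State) : State :=
  { s with drawn := s.drawn + 1 }

end State

/-- The effect of an elementary instruction, given the random tape `ω`. For a random number `u`
that is uniform in `[0,1]` and for `m ≥ 1`, the number `⌊u * m⌋` is uniform in `{0, …, m - 1}`
(almost surely). Division by zero gives zero. -/
noncomputable def Instr.eval (ω : RandomTape) : Instr → State → State
  | natConst dst c, s => s.setNat dst c
  | natCopy dst a, s => s.setNat dst (s.natReg a)
  | natSucc dst a, s => s.setNat dst (s.natReg a + 1)
  | natPred dst a, s => s.setNat dst (s.natReg a - 1)
  | natLoad dst arr idx, s => s.setNat dst (s.natArr arr (s.natReg idx))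
  | natStore arr idx a, s => s.setNatArr arr (s.natReg idx) (s.natReg a)
  | realConst dst q, s => s.setReal dst (q : ℝ)
  | realCopy dst a, s => s.setReal dst (s.realReg a)
  | realAdd dst a b, s => s.setReal dst (s.realReg a + s.realReg b)
  | realSub dst a b, s => s.setReal dst (s.realReg a - s.realReg b)
  | realMul dst a b, s => s.setReal dst (s.realReg a * s.realReg b)
  | realDiv dst a b, s => s.setReal dst (s.realReg a / s.realReg b)
  | realLoad dst arr idx, s => s.setReal dst (s.realArr arr (s.natReg idx))
  | realStore arr idx a, s => s.setRealArr arr (s.natReg idx) (s.realReg a)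
  | randIndex dst bound, s =>
      (s.setNat dst ⌊(ω s.drawn : ℝ) * (s.natReg bound : ℝ)⌋₊).advance
  | randReal dst, s => (s.setReal dst (ω s.drawn : ℝ)).advance

/-- The truth of a test in a state. -/
def Test.holds : Test → State → Prop
  | natLt a b, s => s.natReg a < s.natReg b
  | realLt a b, s => s.realReg a < s.realReg b

/-- `Exec ω P s s' t`: with the random tape `ω`, the program `P` started in the state `s` halts in
the state `s'` after `t` steps. -/
inductive Exec (ω : RandomTape) : Program → State → State → ℕ → Prop
  | skip (s : State) : Exec ω .skip s s 1
  | instr (c : Instr) (s : State) : Exec ω (.instr c) s (c.eval ω s) 1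
  | seq {P Q : Program} {s s' s'' : State} {t t' : ℕ} :
      Exec ω P s s' t → Exec ω Q s' s'' t' → Exec ω (.seq P Q) s s'' (t + t')
  | iteTrue {b : Test} {P Q : Program} {s s' : State} {t : ℕ} :
      b.holds s → Exec ω P s s' t → Exec ω (.ite b P Q) s s' (t + 1)
  | iteFalse {b : Test} {P Q : Program} {s s' : State} {t : ℕ} :
      ¬ b.holds s → Exec ω Q s s' t → Exec ω (.ite b P Q) s s' (t + 1)
  | loopFalse {b : Test} {P : Program} {s : State} :
      ¬ b.holds s → Exec ω (.loop b P) s s 1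
  | loopTrue {b : Test} {P : Program} {s s' s'' : State} {t t' : ℕ} :
      b.holds s → Exec ω P s s' t → Exec ω (.loop b P) s' s'' t' →
      Exec ω (.loop b P) s s'' (t + t' + 1)

/-- For a fixed random tape, the final state and the number of steps are determined. -/
theorem Exec.deterministic {ω : RandomTape} {P : Program} {s s₁ s₂ : State} {t₁ t₂ : ℕ}
    (h₁ : Exec ω P s s₁ t₁) (h₂ : Exec ω P s s₂ t₂) : s₁ = s₂ ∧ t₁ = t₂ := by
  induction h₁ generalizing s₂ t₂ with
  | skip s => cases h₂; exact ⟨rfl, rfl⟩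
  | instr c s => cases h₂; exact ⟨rfl, rfl⟩
  | seq _ _ ih ih' =>
    cases h₂ with
    | seq k k' =>
      obtain ⟨rfl, rfl⟩ := ih k
      obtain ⟨rfl, rfl⟩ := ih' k'
      exact ⟨rfl, rfl⟩
  | iteTrue hb _ ih =>
    cases h₂ with
    | iteTrue _ k => obtain ⟨rfl, rfl⟩ := ih k; exact ⟨rfl, rfl⟩
    | iteFalse nb _ => exact absurd hb nb
  | iteFalse nb _ ih =>
    cases h₂ with
    | iteTrue hb _ => exact absurd hb nb
    | iteFalse _ k => obtain ⟨rfl, rfl⟩ := ih k; exact ⟨rfl, rfl⟩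
  | loopFalse nb =>
    cases h₂ with
    | loopFalse _ => exact ⟨rfl, rfl⟩
    | loopTrue hb _ _ => exact absurd hb nb
  | loopTrue hb _ _ ih ih' =>
    cases h₂ with
    | loopFalse nb => exact absurd hb nb
    | loopTrue _ k k' =>
      obtain ⟨rfl, rfl⟩ := ih k
      obtain ⟨rfl, rfl⟩ := ih' k'
      exact ⟨rfl, rfl⟩

/-! ### Input and output -/

/-- The initial state for a collection of `n` balls: the natural register `0` holds `n`, the `i`-th
cell of the real array `k < d` holds the `k`-th coordinate of the center of the `i`-th ball, the
`i`-th cell of the real array `d` holds its radius, and everything else is zero. -/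
noncomputable def inputState {d n : ℕ} (B : Fin n → EuclideanBall d) : State where
  natReg r := if r = 0 then n else 0
  realReg _ := 0
  natArr _ _ := 0
  realArr a i :=
    if hi : i < n then
      if ha : a < d then (B ⟨i, hi⟩).center ⟨a, ha⟩
      else if a = d then (B ⟨i, hi⟩).radius else 0
    else 0
  drawn := 0

/-- The set of balls described by a final state: the `i`-th cell of the natural array `0` is a flag
that tells whether the `i`-th ball belongs to the set. -/
def outputSet (n : ℕ) (s : State) : Set (Fin n) :=
  {i | s.natArr 0 (i : ℕ) = 1}

end BallSeparator

namespace BallSeparator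
open MeasureTheory Metric Set
open scoped ENNReal

section Ply
variable {d n : ℕ} (B : Fin n → EuclideanBall d)

theorem pointPly_le (x : EuclideanSpace ℝ (Fin d)) : pointPly B x ≤ n := by
  simpa [pointPly] using Set.ncard_le_ncard (Set.subset_univ {i : Fin n | x ∈ (B i).carrier})

theorem pointPly_le_ballPly {i : Fin n} {x : EuclideanSpace ℝ (Fin d)}
    (hx : x ∈ (B i).carrier) : pointPly B x ≤ ballPly B i :=
  le_csSup ⟨n, by rintro _ ⟨y, -, rfl⟩; exact pointPly_le B y⟩ ⟨x, hx, rfl⟩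

theorem card_le_pointPly {I : Finset (Fin n)} {x : EuclideanSpace ℝ (Fin d)}
    (hI : ∀ i ∈ I, x ∈ (B i).carrier) : I.card ≤ pointPly B x := by
  rw [← Set.ncard_coe_finset]
  exact Set.ncard_le_ncard (fun i hi => hI i hi)

theorem center_mem_carrier (b : EuclideanBall d) : b.center ∈ b.carrier :=
  Metric.mem_closedBall_self b.radius_pos.le

theorem one_le_ballPly (i : Fin n) : 1 ≤ ballPly B i := by
  refine le_trans ?_ (pointPly_le_ballPly B (center_mem_carrier (B i)))
  simpa using card_le_pointPly B (I := {i}) (x := (B i).center)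
    (by simpa using center_mem_carrier (B i))

theorem ballPly_pos (i : Fin n) : (0 : ℝ) < ballPly B i := by
  exact_mod_cast one_le_ballPly B i

/-- Balls with a common point contribute at most one to the sum of the reciprocal plies. -/
theorem sum_one_div_ballPly_le_one {I : Finset (Fin n)} {x : EuclideanSpace ℝ (Fin d)}
    (hI : ∀ i ∈ I, x ∈ (B i).carrier) : ∑ i ∈ I, 1 / (ballPly B i : ℝ) ≤ 1 := by
  rcases I.eq_empty_or_nonempty with rfl | hne
  · simp
  have hc : (0 : ℝ) < I.card := by exact_mod_cast hne.card_pos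
  calc ∑ i ∈ I, 1 / (ballPly B i : ℝ) ≤ ∑ i ∈ I, 1 / (I.card : ℝ) := by
        refine Finset.sum_le_sum fun i hi => one_div_le_one_div_of_le hc ?_
        exact_mod_cast (card_le_pointPly B hI).trans (pointPly_le_ballPly B (hI i hi))
    _ = 1 := by rw [Finset.sum_const, nsmul_eq_mul, mul_one_div_cancel hc.ne']

/-- Volume bound for balls `closedBall (c i) (s i) ⊆ B i` inside a ball of radius `R`. -/
theorem sum_pow_div_ballPly_le {I : Finset (Fin n)} {s : Fin n → ℝ} (hs : ∀ i ∈ I, 0 ≤ s i)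
    {c : Fin n → EuclideanSpace ℝ (Fin d)} {x : EuclideanSpace ℝ (Fin d)} {R : ℝ} (hR : 0 ≤ R)
    (h₁ : ∀ i ∈ I, closedBall (c i) (s i) ⊆ (B i).carrier)
    (h₂ : ∀ i ∈ I, closedBall (c i) (s i) ⊆ closedBall x R) :
    ∑ i ∈ I, s i ^ d / (ballPly B i : ℝ) ≤ R ^ d := by
  have key : ∑ i ∈ I, ENNReal.ofReal (1 / ballPly B i) *
      volume (closedBall (c i) (s i)) ≤ volume (closedBall x R) := by
    calc _ = ∑ i ∈ I, ∫⁻ y, (closedBall (c i) (s i)).indicator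
          (fun _ => ENNReal.ofReal (1 / ballPly B i)) y := by
          refine Finset.sum_congr rfl fun i _ => ?_
          rw [lintegral_indicator_const measurableSet_closedBall]
      _ = ∫⁻ y, ∑ i ∈ I, (closedBall (c i) (s i)).indicator
          (fun _ => ENNReal.ofReal (1 / ballPly B i)) y := by
          rw [lintegral_finsetSum]
          exact fun i _ => measurable_const.indicator measurableSet_closedBall
      _ ≤ ∫⁻ y, (closedBall x R).indicator (fun _ => 1) y := by
          refine lintegral_mono fun y => ?_
          by_cases hy : y ∈ closedBall x R
          · classical
            rw [Set.indicator_of_mem hy]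
            simp only [Set.indicator_apply]
            rw [← Finset.sum_filter, ← ENNReal.ofReal_sum_of_nonneg
              (fun i _ => (one_div_pos.2 (ballPly_pos B i)).le)]
            rw [ENNReal.ofReal_le_one]
            refine sum_one_div_ballPly_le_one B (x := y) fun i hi => ?_
            rw [Finset.mem_filter] at hi
            exact h₁ i hi.1 hi.2
          · refine le_of_eq_of_le (Finset.sum_eq_zero fun i hi => ?_) zero_le
            exact Set.indicator_of_notMem (fun h => hy (h₂ i hi h)) _
      _ = _ := by rw [lintegral_indicator_const measurableSet_closedBall, one_mul]
  have hV0 : volume (ball (0 : EuclideanSpace ℝ (Fin d)) 1) ≠ 0 :=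
    (measure_ball_pos _ _ one_pos).ne'
  have hVt : volume (ball (0 : EuclideanSpace ℝ (Fin d)) 1) ≠ ∞ := measure_ball_lt_top.ne
  rw [Measure.addHaar_closedBall _ _ hR, finrank_euclideanSpace_fin] at key
  have key2 : (∑ i ∈ I, ENNReal.ofReal (s i ^ d / ballPly B i)) *
      volume (ball (0 : EuclideanSpace ℝ (Fin d)) 1) ≤ ENNReal.ofReal (R ^ d) *
      volume (ball (0 : EuclideanSpace ℝ (Fin d)) 1) := by
    refine le_of_eq_of_le ?_ key
    rw [Finset.sum_mul]
    refine Finset.sum_congr rfl fun i hi => ?_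
    rw [Measure.addHaar_closedBall _ _ (hs i hi), finrank_euclideanSpace_fin, ← mul_assoc,
      ← ENNReal.ofReal_mul (one_div_pos.2 (ballPly_pos B i)).le]
    congr 2
    ring
  rw [ENNReal.mul_le_mul_iff_left hV0 hVt, ← ENNReal.ofReal_sum_of_nonneg
    (fun i hi => div_nonneg (pow_nonneg (hs i hi) _) (ballPly_pos B i).le)] at key2
  exact (ENNReal.ofReal_le_ofReal_iff (pow_nonneg hR _)).1 key2

theorem separatorBound_nonneg : 0 ≤ separatorBound B :=
  Real.rpow_nonneg (Finset.sum_nonneg fun _ _ => Real.rpow_nonneg (Nat.cast_nonneg _) _) _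

/-- Hölder's inequality with the weights given by the plies. -/
theorem sum_le_mul_separatorBound (hd : 2 ≤ d) {I : Finset (Fin n)} {s : Fin n → ℝ}
    (hs : ∀ i ∈ I, 0 ≤ s i) {R : ℝ} (hR : 0 ≤ R)
    (h : ∑ i ∈ I, s i ^ d / (ballPly B i : ℝ) ≤ R ^ d) :
    ∑ i ∈ I, s i ≤ R * separatorBound B := by
  have hd' : (2 : ℝ) ≤ d := by exact_mod_cast hd
  have hd0 : (d : ℝ) ≠ 0 := by positivity
  have hpq : (d : ℝ).HolderConjugate ((d : ℝ) / ((d : ℝ) - 1)) :=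
    Real.HolderConjugate.conjExponent (by linarith)
  have hp : ∀ i, (0 : ℝ) < ballPly B i := ballPly_pos B
  have H := Real.inner_le_Lp_mul_Lq_of_nonneg I (f := fun i => s i / (ballPly B i : ℝ) ^ (1 / (d : ℝ)))
    (g := fun i => (ballPly B i : ℝ) ^ (1 / (d : ℝ))) hpq
    (fun i hi => div_nonneg (hs i hi) (Real.rpow_nonneg (hp i).le _))
    (fun i _ => Real.rpow_nonneg (hp i).le _)
  have e1 : ∀ i ∈ I, s i / (ballPly B i : ℝ) ^ (1 / (d : ℝ)) * (ballPly B i : ℝ) ^ (1 / (d : ℝ))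
      = s i := fun i _ => div_mul_cancel₀ _ (Real.rpow_pos_of_pos (hp i) _).ne'
  have e2 : ∀ i ∈ I, (s i / (ballPly B i : ℝ) ^ (1 / (d : ℝ))) ^ (d : ℝ)
      = s i ^ d / (ballPly B i : ℝ) := fun i hi => by
    rw [Real.div_rpow (hs i hi) (Real.rpow_nonneg (hp i).le _), ← Real.rpow_mul (hp i).le,
      one_div_mul_cancel hd0, Real.rpow_one, Real.rpow_natCast]
  have e3 : ∀ i ∈ I, ((ballPly B i : ℝ) ^ (1 / (d : ℝ))) ^ ((d : ℝ) / ((d : ℝ) - 1))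
      = (ballPly B i : ℝ) ^ (1 / ((d : ℝ) - 1)) := fun i hi => by
    rw [← Real.rpow_mul (hp i).le]
    congr 1
    have : (d : ℝ) - 1 ≠ 0 := by linarith
    field_simp
  have e4 : 1 / ((d : ℝ) / ((d : ℝ) - 1)) = 1 - 1 / (d : ℝ) := by
    have : (d : ℝ) - 1 ≠ 0 := by linarith
    field_simp
  rw [Finset.sum_congr rfl e1, Finset.sum_congr rfl e2, Finset.sum_congr rfl e3, e4] at H
  refine H.trans (mul_le_mul ?_ ?_ ?_ hR)
  · calc _ ≤ (R ^ d) ^ (1 / (d : ℝ)) := Real.rpow_le_rpow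
          (Finset.sum_nonneg fun i hi => div_nonneg (pow_nonneg (hs i hi) _) (hp i).le) h
          (by positivity)
      _ = R := by
          rw [← Real.rpow_natCast, ← Real.rpow_mul hR, mul_one_div_cancel hd0, Real.rpow_one]
  · refine Real.rpow_le_rpow (Finset.sum_nonneg fun i _ => Real.rpow_nonneg (hp i).le _)
      (Finset.sum_le_sum_of_subset_of_nonneg (Finset.subset_univ _)
        fun i _ _ => Real.rpow_nonneg (hp i).le _) ?_
    rw [sub_nonneg, div_le_one (by linarith)]
    linarith
  · exact Real.rpow_nonneg (Finset.sum_nonneg fun i _ => Real.rpow_nonneg (hp i).le _) _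

/-- The balls that meet `closedBall x (2 * r)`, weighted by their radii truncated at `r`. -/
theorem sum_min_radius_le (hd : 2 ≤ d) (x : EuclideanSpace ℝ (Fin d)) {r : ℝ} (hr : 0 ≤ r)
    {I : Finset (Fin n)} (hI : ∀ i ∈ I, dist (B i).center x ≤ 2 * r + (B i).radius) :
    ∑ i ∈ I, min (B i).radius r ≤ 4 * r * separatorBound B := by
  have hs : ∀ i, 0 ≤ min (B i).radius r := fun i => le_min (B i).radius_pos.le hr
  have hc : ∀ i, ∃ c, i ∈ I → dist (B i).center c ≤ (B i).radius - min (B i).radius r ∧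
      dist c x ≤ 2 * r + min (B i).radius r := by
    intro i
    by_cases hi : i ∈ I
    · obtain ⟨c, h₁, h₂⟩ := exists_dist_le_le (δ := (B i).radius - min (B i).radius r)
        (ε := 2 * r + min (B i).radius r) (sub_nonneg.2 (min_le_left _ _))
        (by have := hs i; positivity) (by linarith [hI i hi])
      exact ⟨c, fun _ => ⟨h₁, h₂⟩⟩
    · exact ⟨0, fun h => absurd h hi⟩
  choose c hc using hc
  refine sum_le_mul_separatorBound B hd (fun i _ => hs i) (by positivity) ?_
  refine sum_pow_div_ballPly_le B (c := c) (x := x) (fun i _ => hs i) (by positivity) ?_ ?_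
  · intro i hi
    refine closedBall_subset_closedBall' ?_
    rw [dist_comm]
    linarith [(hc i hi).1]
  · intro i hi
    refine closedBall_subset_closedBall' ?_
    linarith [(hc i hi).2, min_le_right (B i).radius r]

theorem card_le_separatorBound (hd : 2 ≤ d) {I : Finset (Fin n)} {x : EuclideanSpace ℝ (Fin d)}
    (hI : ∀ i ∈ I, x ∈ (B i).carrier) : (I.card : ℝ) ≤ separatorBound B := by
  have := sum_le_mul_separatorBound B hd (I := I) (s := fun _ => 1) (R := 1) (by simp) zero_le_one
    (by simpa using sum_one_div_ballPly_le_one B hI)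
  simpa using this

end Ply

/-! ### Spheres of random radius -/

/-- The radius of the separating sphere. -/
noncomputable def sphereRadius (r : ℝ) (u : unitInterval) : ℝ := r * √(1 + 3 * (u : ℝ))

theorem le_sphereRadius {r : ℝ} (hr : 0 ≤ r) (u : unitInterval) : r ≤ sphereRadius r u := by
  have h : 1 ≤ √(1 + 3 * (u : ℝ)) := Real.one_le_sqrt.2 (by linarith [u.2.1])
  simpa [sphereRadius] using mul_le_mul_of_nonneg_left h hr

theorem sphereRadius_le {r : ℝ} (hr : 0 ≤ r) (u : unitInterval) : sphereRadius r u ≤ 2 * r := by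
  have h : √(1 + 3 * (u : ℝ)) ≤ 2 := Real.sqrt_le_iff.2 ⟨by norm_num, by linarith [u.2.2]⟩
  rw [mul_comm 2]
  exact mul_le_mul_of_nonneg_left h hr

theorem sphereRadius_sq (r : ℝ) (u : unitInterval) :
    sphereRadius r u ^ 2 = r ^ 2 * (1 + 3 * (u : ℝ)) := by
  rw [sphereRadius, mul_pow, Real.sq_sqrt (by linarith [u.2.1])]

theorem measurable_sphereRadius (r : ℝ) : Measurable (sphereRadius r) := by
  unfold sphereRadius
  fun_prop

theorem mul_abs_sub_le {r : ℝ} (hr : 0 < r) (u v : unitInterval) :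
    3 * r * |(u : ℝ) - v| ≤ 4 * |sphereRadius r u - sphereRadius r v| := by
  have h1 := sphereRadius_sq r u
  have h2 := sphereRadius_sq r v
  have h3 : |sphereRadius r u - sphereRadius r v| * (sphereRadius r u + sphereRadius r v) =
      3 * r ^ 2 * |(u : ℝ) - v| := by
    have hu := le_sphereRadius hr.le u
    have hv := le_sphereRadius hr.le v
    rw [← abs_of_nonneg (a := sphereRadius r u + sphereRadius r v) (by linarith), ← abs_mul,
      ← abs_of_nonneg (a := 3 * r ^ 2) (by positivity), ← abs_mul]
    congr 1
    linear_combination h1 - h2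
  have h4 : sphereRadius r u + sphereRadius r v ≤ 4 * r := by
    linarith [sphereRadius_le hr.le u, sphereRadius_le hr.le v]
  have h5 := mul_le_mul_of_nonneg_left h4 (abs_nonneg (sphereRadius r u - sphereRadius r v))
  nlinarith

/-- The probability that the random sphere meets a given ball. -/
theorem volume_abs_sub_sphereRadius_le {r D ρ : ℝ} (hr : 0 < r) (hρ : 0 ≤ ρ) :
    volume {u : unitInterval | |D - sphereRadius r u| ≤ ρ} ≤
      ENNReal.ofReal (3 / r * min ρ r) := by
  set S := {u : unitInterval | |D - sphereRadius r u| ≤ ρ} with hS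
  rcases le_total r ρ with h | h
  · refine prob_le_one.trans ?_
    rw [min_eq_right h, div_mul_cancel₀ _ hr.ne']
    norm_num
  · rw [min_eq_left h]
    have e : volume S = volume (Subtype.val '' S) := by
      rw [Measure.Subtype.volume_def, comap_subtype_coe_apply measurableSet_Icc]
    rw [e]
    refine (Real.volume_le_diam _).trans (Metric.ediam_le ?_)
    rintro _ ⟨u, hu, rfl⟩ _ ⟨v, hv, rfl⟩
    rw [edist_dist, Real.dist_eq]
    refine ENNReal.ofReal_le_ofReal ?_
    have h1 := mul_abs_sub_le hr u v
    have h2 : |sphereRadius r u - sphereRadius r v| ≤ 2 * ρ := by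
      have hu' := abs_le.1 (show |D - sphereRadius r u| ≤ ρ from hu)
      have hv' := abs_le.1 (show |D - sphereRadius r v| ≤ ρ from hv)
      rw [abs_le]
      constructor <;> linarith
    rw [div_mul_eq_mul_div, le_div_iff₀ hr]
    nlinarith

end BallSeparator

namespace BallSeparator
open MeasureTheory Metric Set
open scoped ENNReal

/-! ### One round of the separator construction -/

/-- The position of a ball of radius `ρ`, whose center has distance `D` from the center of a sphere
of radius `R`: it may meet the sphere (`1`), lie inside (`2`) or lie outside (`0`). -/
noncomputable def side (D ρ R : ℝ) : ℕ := if |D - R| ≤ ρ then 1 else if D < R then 2 else 0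

theorem side_eq_one {D ρ R : ℝ} : side D ρ R = 1 ↔ |D - R| ≤ ρ := by
  unfold side; split_ifs <;> simp_all

theorem side_eq_two {D ρ R : ℝ} : side D ρ R = 2 ↔ ρ < R - D ∧ D < R := by
  unfold side
  split_ifs with h₁ h₂
  · simp only [OfNat.one_ne_ofNat, false_iff, not_and, not_lt]
    intro h
    have := abs_le.1 h₁
    linarith
  · simp only [h₂, and_true, true_iff]
    rw [abs_sub_comm, abs_of_pos (by linarith)] at h₁
    linarith
  · simp [h₂]

theorem side_eq_zero {D ρ R : ℝ} (hρ : 0 < ρ) : side D ρ R = 0 ↔ ρ < D - R := by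
  unfold side
  split_ifs with h₁ h₂
  · simp only [false_iff, not_lt]
    exact (le_abs_self _).trans h₁
  · simp only [false_iff, not_lt]
    linarith
  · simp only [true_iff]
    rwa [abs_of_nonneg (by linarith), not_le] at h₁

theorem side_cases (D ρ R : ℝ) : side D ρ R = 0 ∨ side D ρ R = 1 ∨ side D ρ R = 2 := by
  unfold side; split_ifs <;> simp

section Round
variable {d n : ℕ} (B : Fin n → EuclideanBall d)

/-- The centers of the balls, extended by zero. -/
noncomputable def ctr (i : ℕ) : EuclideanSpace ℝ (Fin d) :=
  if h : i < n then (B ⟨i, h⟩).center else 0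

@[simp] theorem ctr_val (i : Fin n) : ctr B i = (B i).center := by simp [ctr]

/-- The positions of the balls with respect to the sphere around the center of the ball `q`, whose
radius is determined by the center of the ball `q'` and the random number `u`. -/
noncomputable def sides (q q' : ℕ) (u : unitInterval) : Fin n → ℕ := fun i =>
  side (dist (B i).center (ctr B q)) (B i).radius (sphereRadius (dist (ctr B q) (ctr B q')) u)

/-- The effect of a round on the labels: `0` for the active balls, `1` for the separator, `2` for
the balls that have been split off. -/
def relabel (A c : Fin n → ℕ) : Fin n → ℕ :=
  if 3 * (Finset.univ.filter fun i => A i = 0 ∧ c i = 2).card ≤ 2 * n then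
    fun i => if A i = 0 then c i else A i
  else A

theorem active_of_relabel {A c : Fin n → ℕ} {i : Fin n} (h : relabel A c i = 0) : A i = 0 := by
  unfold relabel at h
  split_ifs at h
  · by_contra h0
    simp [h0] at h
  · exact h

theorem card_separator_relabel_le (A c : Fin n → ℕ) :
    (Finset.univ.filter fun i => relabel A c i = 1).card ≤
      (Finset.univ.filter fun i => A i = 1).card + (Finset.univ.filter fun i => c i = 1).card := by
  refine le_trans (Finset.card_le_card fun i hi => ?_) (Finset.card_union_le _ _)
  simp only [Finset.mem_filter, Finset.mem_univ, true_and, Finset.mem_union] at hi ⊢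
  unfold relabel at hi
  split_ifs at hi
  · dsimp only at hi
    by_cases h0 : A i = 0
    · rw [if_pos h0] at hi; exact Or.inr hi
    · rw [if_neg h0] at hi; exact Or.inl hi
  · exact Or.inl hi

theorem card_active_relabel_add_le {A c : Fin n → ℕ}
    (h : 3 * (Finset.univ.filter fun i => A i = 0 ∧ c i = 2).card ≤ 2 * n)
    {P : Finset (Fin n)} (hP : ∀ i ∈ P, A i = 0 ∧ c i ≠ 0) :
    (Finset.univ.filter fun i => relabel A c i = 0).card + P.card ≤
      (Finset.univ.filter fun i => A i = 0).card := by
  rw [← Finset.card_union_of_disjoint]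
  · refine Finset.card_le_card fun i hi => ?_
    simp only [Finset.mem_filter, Finset.mem_univ, true_and, Finset.mem_union] at hi ⊢
    exact hi.elim active_of_relabel fun hi => (hP i hi).1
  · rw [Finset.disjoint_left]
    intro i hi hi'
    simp only [Finset.mem_filter, Finset.mem_univ, true_and] at hi
    rw [relabel, if_pos h] at hi
    simp [hP i hi'] at hi

theorem card_active_relabel_le (A c : Fin n → ℕ) :
    (Finset.univ.filter fun i => relabel A c i = 0).card ≤
      (Finset.univ.filter fun i => A i = 0).card :=
  Finset.card_le_card fun i hi => by
    simp only [Finset.mem_filter, Finset.mem_univ, true_and] at hi ⊢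
    exact active_of_relabel hi

/-- The active balls and the groups that have been split off are pairwise separated, and every group
that has been split off is small. -/
def IsSeparating (A : Fin n → ℕ) : Prop :=
  ∃ (g : Fin n → ℕ) (N : ℕ), 0 < N ∧ (∀ i, g i < N) ∧ (∀ i, A i ≠ 1 → (A i = 0 ↔ g i = 0)) ∧
    (∀ i j, (intersectionGraph B).Adj i j → A i ≠ 1 → A j ≠ 1 → g i = g j) ∧
    ∀ k, k ≠ 0 → 3 * (Finset.univ.filter fun i => A i ≠ 1 ∧ g i = k).card ≤ 2 * n

theorem isSeparating_zero : IsSeparating B (fun _ => 0) :=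
  ⟨fun _ => 0, 1, one_pos, fun _ => one_pos, by simp, by simp, fun k hk => by
    simp [hk.symm]⟩

theorem not_adj_of_sides {x : EuclideanSpace ℝ (Fin d)} {R : ℝ} {i j : Fin n}
    (hi : side (dist (B i).center x) (B i).radius R = 2)
    (hj : side (dist (B j).center x) (B j).radius R = 0) :
    ¬ (intersectionGraph B).Adj i j := by
  rintro ⟨-, z, hzi, hzj⟩
  rw [side_eq_two] at hi
  rw [side_eq_zero (B j).radius_pos] at hj
  have h1 : dist z (B i).center ≤ (B i).radius := hzi
  have h2 : dist z (B j).center ≤ (B j).radius := hzj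
  have h3 := dist_triangle z (B i).center x
  have h4 := dist_triangle_left (B j).center x z
  linarith

theorem IsSeparating.relabel {A : Fin n → ℕ} (hA : IsSeparating B A) (q q' : ℕ)
    (u : unitInterval) : IsSeparating B (relabel A (sides B q q' u)) := by
  unfold BallSeparator.relabel
  split_ifs with hc
  swap
  · exact hA
  obtain ⟨g, N, hN, hg, h0, hadj, hsmall⟩ := hA
  set c := sides B q q' u with hcdef
  have hc3 : ∀ i, c i = 0 ∨ c i = 1 ∨ c i = 2 := fun i => side_cases _ _ _
  have hc20 : ∀ i j, c i = 2 → c j = 0 → ¬ (intersectionGraph B).Adj i j :=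
    fun i j hi hj => not_adj_of_sides B hi hj
  refine ⟨fun i => if A i = 0 ∧ c i = 2 then N else g i, N + 1, by omega, ?_, ?_, ?_, ?_⟩
  · intro i
    have := hg i
    dsimp only
    split_ifs <;> omega
  · intro i hi
    have h0i := h0 i
    have := hc3 i
    by_cases hAi : A i = 0
    · simp only [hAi, if_true, true_and] at hi ⊢
      by_cases hci : c i = 2
      · simp [hci, hN.ne']
      · rw [if_neg hci]
        omega
    · simp only [hAi, if_false, false_and] at hi ⊢
      simpa [hAi] using h0i hi
  · intro i j hij hi hj
    have h0i := h0 i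
    have h0j := h0 j
    have hA' := hadj i j hij
    have h1 := fun h h' => hc20 i j h h' hij
    have h2 := fun h h' => hc20 j i h h' hij.symm
    have := hc3 i
    have := hc3 j
    by_cases hAi : A i = 0 <;> by_cases hAj : A j = 0 <;>
      simp only [hAi, hAj, if_true, if_false, true_and, false_and] at hi hj ⊢
    · have : g i = g j := hA' (by omega) (by omega)
      by_cases hci : c i = 2 <;> by_cases hcj : c j = 2 <;> simp only [hci, hcj, if_true, if_false]
      · exact absurd (by omega) (h1 hci)
      · exact absurd (by omega) (h2 hcj)
      · exact this
    · have := hA' (by omega) hj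
      have := h0i (by omega)
      have := h0j hj
      omega
    · have := hA' hi (by omega)
      have := h0i hi
      have := h0j (by omega)
      omega
    · exact hA' hi hj
  · intro k hk
    by_cases hkN : k = N
    · refine le_trans (Nat.mul_le_mul_left 3 (Finset.card_le_card fun i hi => ?_)) hc
      simp only [Finset.mem_filter, Finset.mem_univ, true_and] at hi ⊢
      by_contra hcon
      rw [if_neg hcon] at hi
      exact absurd hi.2 (by have := hg i; omega)
    · refine le_trans (Nat.mul_le_mul_left 3 (Finset.card_le_card fun i hi => ?_)) (hsmall k hk)
      simp only [Finset.mem_filter, Finset.mem_univ, true_and] at hi ⊢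
      obtain ⟨hi1, hi2⟩ := hi
      split_ifs at hi2 with hcon
      · exact absurd hi2.symm hkN
      · by_cases hAi : A i = 0
        · exact absurd ((h0 i (by omega)).1 hAi) (by omega)
        · rw [if_neg hAi] at hi1
          exact ⟨hi1, hi2⟩

theorem IsSeparating.isBalancedSeparator {A : Fin n → ℕ} (hA : IsSeparating B A)
    (hact : 3 * (Finset.univ.filter fun i => A i = 0).card ≤ 2 * n) :
    IsBalancedSeparator (intersectionGraph B) {i | A i = 1} := by
  obtain ⟨g, N, hN, hg, h0, hadj, hsmall⟩ := hA
  intro K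
  obtain ⟨v, rfl⟩ := K.exists_rep
  set G := (intersectionGraph B).induce {i | A i = 1}ᶜ with hG
  have hwalk : ∀ w w' : ↥({i | A i = 1}ᶜ : Set (Fin n)), G.Walk w w' → g w = g w' := by
    intro w w' p
    induction p with
    | nil => rfl
    | @cons a b c hab _ ih => exact (hadj a b hab a.2 b.2).trans ih
  have hgroup : 3 * (Finset.univ.filter fun i => A i ≠ 1 ∧ g i = g v).card ≤ 2 * n := by
    by_cases hk : g v = 0
    · refine le_trans (Nat.mul_le_mul_left 3 (Finset.card_le_card fun i hi => ?_)) hact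
      simp only [Finset.mem_filter, Finset.mem_univ, true_and] at hi ⊢
      exact (h0 i hi.1).2 (hi.2.trans hk)
    · exact hsmall _ hk
  have hle : (G.connectedComponentMk v).supp.ncard ≤
      (Finset.univ.filter fun i => A i ≠ 1 ∧ g i = g v).card := by
    rw [← Set.ncard_image_of_injective _ Subtype.val_injective, ← Set.ncard_coe_finset]
    refine Set.ncard_le_ncard ?_
    rintro _ ⟨w, hw, rfl⟩
    simp only [Finset.coe_filter, Finset.mem_univ, true_and, Set.mem_ofPred_eq]
    refine ⟨w.2, ?_⟩
    obtain ⟨p⟩ := SimpleGraph.ConnectedComponent.exact hw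
    exact hwalk _ _ p
  have h3 : (3 : ℝ) * (G.connectedComponentMk v).supp.ncard ≤ 2 * n := by
    exact_mod_cast (Nat.mul_le_mul_left 3 hle).trans hgroup
  rw [Nat.card_fin]
  change (((G.connectedComponentMk v).supp.ncard : ℕ) : ℝ) ≤ _
  linarith

/-! ### The expected number of balls that meet the random sphere -/

theorem measurable_sides (q q' : ℕ) : Measurable (sides B q q') := by
  refine measurable_pi_iff.2 fun i => ?_
  have hm := measurable_sphereRadius (dist (ctr B q) (ctr B q'))
  refine Measurable.ite (measurableSet_le (by fun_prop) measurable_const) measurable_const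
    (Measurable.ite (measurableSet_lt measurable_const hm) measurable_const measurable_const)

theorem lintegral_card_sides_le (hd : 2 ≤ d) (q q' : ℕ) :
    ∫⁻ u, ((Finset.univ.filter fun i => sides B q q' u i = 1).card : ℝ≥0∞) ≤
      ENNReal.ofReal (12 * separatorBound B) := by
  set x := ctr B q
  set r := dist x (ctr B q') with hrdef
  have hr : 0 ≤ r := dist_nonneg
  have hS := separatorBound_nonneg B
  rcases hr.eq_or_lt with h0 | hpos
  · calc _ ≤ ∫⁻ u : unitInterval, ENNReal.ofReal (separatorBound B) := by
          refine lintegral_mono fun u => ?_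
          rw [← ENNReal.ofReal_natCast]
          refine ENNReal.ofReal_le_ofReal (card_le_separatorBound B hd (x := x) fun i hi => ?_)
          simp only [Finset.mem_filter, Finset.mem_univ, true_and, sides, side_eq_one] at hi
          rw [← hrdef, ← h0] at hi
          simpa [sphereRadius, EuclideanBall.carrier, dist_comm] using hi
      _ ≤ _ := by
          rw [lintegral_const, measure_univ, mul_one]
          exact ENNReal.ofReal_le_ofReal (by linarith)
  · have hset : ∀ i, {u : unitInterval | sides B q q' u i = 1} =
        {u | |dist (B i).center x - sphereRadius r u| ≤ (B i).radius} := fun i => by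
      ext u
      exact side_eq_one
    have hmeas : ∀ i, MeasurableSet {u : unitInterval | sides B q q' u i = 1} := fun i =>
      (measurable_pi_iff.1 (measurable_sides B q q') i) (measurableSet_singleton 1)
    set I := Finset.univ.filter fun i => dist (B i).center x ≤ 2 * r + (B i).radius with hI
    calc _ = ∫⁻ u, ∑ i, {u : unitInterval | sides B q q' u i = 1}.indicator 1 u := by
          refine lintegral_congr fun u => ?_
          simp [Set.indicator_apply]
      _ = ∑ i, volume {u : unitInterval | sides B q q' u i = 1} := by
          rw [lintegral_finsetSum]
          · exact Finset.sum_congr rfl fun i _ => lintegral_indicator_one (hmeas i)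
          · exact fun i _ => measurable_one.indicator (hmeas i)
      _ = ∑ i ∈ I, volume {u : unitInterval | sides B q q' u i = 1} := by
          refine (Finset.sum_subset (Finset.subset_univ I) fun i _ hi => ?_).symm
          have : {u : unitInterval | sides B q q' u i = 1} = ∅ := by
            rw [hset, Set.eq_empty_iff_forall_notMem]
            intro u hu
            simp only [hI, Finset.mem_filter, Finset.mem_univ, true_and, not_le] at hi
            have h1 := (abs_le.1 (show |dist (B i).center x - sphereRadius r u| ≤ _ from hu)).2
            linarith [sphereRadius_le hr u]
          rw [this, measure_empty]
      _ ≤ ∑ i ∈ I, ENNReal.ofReal (3 / r * min (B i).radius r) := by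
          refine Finset.sum_le_sum fun i _ => ?_
          rw [hset]
          exact volume_abs_sub_sphereRadius_le hpos (B i).radius_pos.le
      _ = ENNReal.ofReal (3 / r * ∑ i ∈ I, min (B i).radius r) := by
          rw [Finset.mul_sum, ENNReal.ofReal_sum_of_nonneg]
          exact fun i _ => mul_nonneg (by positivity) (le_min (B i).radius_pos.le hr)
      _ ≤ _ := by
          refine ENNReal.ofReal_le_ofReal ?_
          have h1 := sum_min_radius_le B hd x hr (I := I) (fun i hi => (Finset.mem_filter.1 hi).2)
          calc _ ≤ 3 / r * (4 * r * separatorBound B) :=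
                mul_le_mul_of_nonneg_left h1 (by positivity)
            _ = _ := by field_simp; ring

end Round

/-! ### Progress -/

/-- The number of balls of radius `r / 4` that suffice to cover a ball of radius `4 * r`. -/
theorem exists_cover (d : ℕ) : ∃ K : ℕ, 0 < K ∧ ∀ (x : EuclideanSpace ℝ (Fin d)) (r : ℝ), 0 < r →
    ∃ t : Finset (EuclideanSpace ℝ (Fin d)), t.card ≤ K ∧ ball x (4 * r) ⊆ ⋃ y ∈ t, ball y (r / 4) := by
  obtain ⟨t, -, htf, ht⟩ := (isCompact_closedBall (0 : EuclideanSpace ℝ (Fin d)) 4).finite_cover_balls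
    (e := 1 / 4) (by norm_num)
  refine ⟨htf.toFinset.card + 1, by omega, fun x r hr => ?_⟩
  classical
  refine ⟨htf.toFinset.image fun y => x + r • y, Finset.card_image_le.trans (by omega), fun z hz => ?_⟩
  have hz' : r⁻¹ • (z - x) ∈ closedBall (0 : EuclideanSpace ℝ (Fin d)) 4 := by
    rw [mem_closedBall_zero_iff, norm_smul, norm_inv, Real.norm_of_nonneg hr.le,
      inv_mul_le_iff₀ hr, ← dist_eq_norm]
    linarith [mem_ball.1 hz]
  obtain ⟨y, hy, hzy⟩ := Set.mem_iUnion₂.1 (ht hz')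
  refine Set.mem_iUnion₂.2 ⟨x + r • y, Finset.mem_image_of_mem _ (htf.mem_toFinset.2 hy), ?_⟩
  rw [mem_ball, dist_eq_norm] at hzy ⊢
  have : z - (x + r • y) = r • (r⁻¹ • (z - x) - y) := by
    rw [smul_sub, smul_inv_smul₀ hr.ne']
    abel
  rw [this, norm_smul, Real.norm_of_nonneg hr.le]
  nlinarith

theorem card_sq_le_sum_card_filter_le {ι : Type*} (W : Finset ι) (f : ι → ℝ) :
    W.card ^ 2 ≤ 2 * ∑ a ∈ W, (W.filter fun b => f b ≤ f a).card := by
  have h : ∑ a ∈ W, (W.filter fun b => f b ≤ f a).card =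
      ∑ a ∈ W, (W.filter fun b => f a ≤ f b).card :=
    (Finset.sum_card_bipartiteAbove_eq_sum_card_bipartiteBelow (fun a b => f a ≤ f b)).symm
  calc W.card ^ 2 = ∑ a ∈ W, W.card := by rw [Finset.sum_const, smul_eq_mul, sq]
    _ ≤ ∑ a ∈ W, ((W.filter fun b => f b ≤ f a).card + (W.filter fun b => f a ≤ f b).card) := by
        refine Finset.sum_le_sum fun a _ => ?_
        classical
        refine le_trans (Finset.card_le_card fun b hb => ?_) (Finset.card_union_le _ _)
        rw [Finset.mem_union, Finset.mem_filter, Finset.mem_filter]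
        exact (le_total (f b) (f a)).imp (fun h => ⟨hb, h⟩) fun h => ⟨hb, h⟩
    _ = _ := by rw [Finset.sum_add_distrib, ← h, two_mul]

/-- In a doubling space, many pairs `q, q'` of points of a finite family have the property that the
ball around `q` of radius `2 * dist q q'` contains few points. -/
theorem exists_good_pairs {X ι : Type*} [PseudoMetricSpace X] (p : ι → X) (V : Finset ι) {K : ℕ}
    (hK : ∀ (x : X) (r : ℝ), 0 < r →
      ∃ t : Finset X, t.card ≤ K ∧ ball x (4 * r) ⊆ ⋃ y ∈ t, ball y (r / 4))
    {μ : ℝ} (hμ : 0 < μ) (hV : μ ≤ V.card) :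
    ∃ (Q : Finset ι) (W : ι → Finset ι), Q ⊆ V ∧ μ ≤ Q.card ∧ ∀ q ∈ Q, W q ⊆ V ∧ μ ≤ (W q).card ∧
      ∀ q' ∈ W q, ((V.filter fun i => dist (p i) (p q) < 2 * dist (p q) (p q')).card : ℝ) ≤ K * μ := by
  classical
  set S := (V ×ˢ V).filter fun a =>
    μ ≤ ((V.filter fun k => dist (p k) (p a.1) ≤ dist (p a.2) (p a.1)).card : ℝ) with hS
  have far : ∀ (x : X) (s : ℝ), μ ≤ ((V.filter fun k => dist (p k) x ≤ s).card : ℝ) →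
      ∃ j ∈ V, dist (p j) x ≤ s ∧
        μ ≤ ((V.filter fun k => dist (p k) x ≤ dist (p j) x).card : ℝ) := by
    intro x s h
    have hne : (V.filter fun k => dist (p k) x ≤ s).Nonempty := by
      rw [← Finset.card_pos]
      exact_mod_cast hμ.trans_le h
    obtain ⟨j, hj, hmax⟩ := Finset.exists_max_image _ (fun k => dist (p k) x) hne
    rw [Finset.mem_filter] at hj
    refine ⟨j, hj.1, hj.2, h.trans ?_⟩
    exact_mod_cast Finset.card_le_card fun k hk =>
      Finset.mem_filter.2 ⟨(Finset.mem_filter.1 hk).1, hmax k hk⟩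
  have hVne : V.Nonempty := by
    rw [← Finset.card_pos]
    exact_mod_cast hμ.trans_le hV
  have hSne : S.Nonempty := by
    obtain ⟨i, hi⟩ := hVne
    obtain ⟨m, -, hm⟩ := Finset.exists_max_image V (fun k => dist (p k) (p i)) ⟨i, hi⟩
    obtain ⟨j, hj, -, hj'⟩ := far (p i) (dist (p m) (p i)) (by
      rwa [Finset.filter_true_of_mem hm])
    exact ⟨(i, j), Finset.mem_filter.2 ⟨Finset.mk_mem_product hi hj, hj'⟩⟩
  obtain ⟨⟨i₀, j₀⟩, h₀, hmin⟩ := Finset.exists_min_image S (fun a => dist (p a.2) (p a.1)) hSne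
  set ρ := dist (p j₀) (p i₀) with hρ
  have hρ0 : 0 ≤ ρ := dist_nonneg
  obtain ⟨h₀V, h₀c⟩ := Finset.mem_filter.1 h₀
  have small : ∀ i ∈ V, ∀ s < ρ, ((V.filter fun k => dist (p k) (p i) ≤ s).card : ℝ) ≤ μ := by
    intro i hi s hs
    by_contra! hcon
    obtain ⟨j, hj, hjs, hj'⟩ := far (p i) s hcon.le
    exact absurd (hmin (i, j) (Finset.mem_filter.2 ⟨Finset.mk_mem_product hi hj, hj'⟩))
      (not_le.2 (hjs.trans_lt hs))
  refine ⟨V.filter fun k => dist (p k) (p i₀) ≤ ρ, fun q => V.filter fun k => dist (p k) (p q) ≤ 2 * ρ,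
    Finset.filter_subset _ _, h₀c, fun q hq => ⟨Finset.filter_subset _ _, h₀c.trans ?_, fun q' hq' => ?_⟩⟩
  · refine Nat.cast_le.2 (Finset.card_le_card fun k hk => ?_)
    rw [Finset.mem_filter] at hk hq ⊢
    refine ⟨hk.1, ?_⟩
    have := dist_triangle_right (p k) (p q) (p i₀)
    linarith [hk.2, hq.2]
  · rcases hρ0.eq_or_lt with h0 | hpos
    · rw [Finset.filter_false_of_mem]
      · simp only [Finset.card_empty, Nat.cast_zero]
        positivity
      · intro i _
        rw [Finset.mem_filter, ← h0, dist_comm] at hq'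
        have := dist_nonneg (x := p i) (y := p q)
        linarith [hq'.2]
    · obtain ⟨t, ht, htcov⟩ := hK (p q) ρ hpos
      have hcov : (V.filter fun i => dist (p i) (p q) < 2 * dist (p q) (p q')) ⊆
          t.biUnion fun y => V.filter fun i => dist (p i) y < ρ / 4 := by
        intro i hi
        rw [Finset.mem_filter] at hi hq'
        have hi4 : p i ∈ ball (p q) (4 * ρ) := by
          rw [mem_ball]
          linarith [hi.2, hq'.2, dist_comm (p q) (p q')]
        obtain ⟨y, hy, hiy⟩ := Set.mem_iUnion₂.1 (htcov hi4)
        exact Finset.mem_biUnion.2 ⟨y, hy, Finset.mem_filter.2 ⟨hi.1, hiy⟩⟩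
      have hpiece : ∀ y ∈ t, ((V.filter fun i => dist (p i) y < ρ / 4).card : ℝ) ≤ μ := by
        intro y _
        rcases (V.filter fun i => dist (p i) y < ρ / 4).eq_empty_or_nonempty with he | ⟨i, hi⟩
        · rw [he]
          simpa using hμ.le
        · rw [Finset.mem_filter] at hi
          refine le_trans (Nat.cast_le.2 (Finset.card_le_card fun k hk => ?_))
            (small i hi.1 (ρ / 2) (by linarith))
          rw [Finset.mem_filter] at hk ⊢
          refine ⟨hk.1, ?_⟩
          have := dist_triangle_right (p k) (p i) y
          linarith [hk.2, hi.2]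
      calc _ ≤ ((t.biUnion fun y => V.filter fun i => dist (p i) y < ρ / 4).card : ℝ) :=
            Nat.cast_le.2 (Finset.card_le_card hcov)
        _ ≤ ∑ y ∈ t, ((V.filter fun i => dist (p i) y < ρ / 4).card : ℝ) := by
            exact_mod_cast Finset.card_biUnion_le
        _ ≤ ∑ y ∈ t, μ := Finset.sum_le_sum hpiece
        _ = t.card * μ := by rw [Finset.sum_const, nsmul_eq_mul]
        _ ≤ K * μ := mul_le_mul_of_nonneg_right (Nat.cast_le.2 ht) hμ.le

end BallSeparator

namespace BallSeparator
open MeasureTheory Metric Set ProbabilityTheory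
open scoped ENNReal

instance : IsProbabilityMeasure tapeMeasure := by unfold tapeMeasure; infer_instance

/-! ### The random labels -/

/-- A state that is determined by the first `k` random numbers is independent of the next one. -/
theorem lintegral_next {σ : Type*} [Countable σ] [MeasurableSpace σ] [DiscreteMeasurableSpace σ]
    (k : ℕ) {S : RandomTape → σ} (hS : Measurable S)
    (hdep : ∀ ω ω' : RandomTape, (∀ i < k, ω i = ω' i) → S ω = S ω')
    {g : σ → unitInterval → ℝ≥0∞} (hg : ∀ a, Measurable (g a)) :
    ∫⁻ ω, g (S ω) (ω k) ∂tapeMeasure = ∫⁻ ω, (∫⁻ u, g (S ω) u) ∂tapeMeasure := by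
  have hI : iIndepFun (fun (i : ℕ) (ω : RandomTape) => ω i) tapeMeasure :=
    iIndepFun_infinitePi (X := fun _ u => u) (fun _ => measurable_id)
  have hI2 := hI.indepFun_finset (Finset.range k) {k} (by simp) (fun i => measurable_pi_apply i)
  let ext : (Finset.range k → unitInterval) → RandomTape := fun x i =>
    if h : i ∈ Finset.range k then x ⟨i, h⟩ else 0
  have hext : Measurable ext := measurable_pi_iff.2 fun i => by
    by_cases h : i ∈ Finset.range k
    · simpa only [ext, h, dif_pos] using measurable_pi_apply _
    · simpa only [ext, h, dif_neg, not_false_iff] using measurable_const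
  have hind : IndepFun S (fun ω : RandomTape => ω k) tapeMeasure := by
    let ψ : (({k} : Finset ℕ) → unitInterval) → unitInterval :=
      fun x => x ⟨k, Finset.mem_singleton_self k⟩
    have hψ : Measurable ψ := measurable_pi_apply _
    have := hI2.comp (φ := S ∘ ext) (hS.comp hext) hψ
    have he : (S ∘ ext) ∘ (fun (ω : RandomTape) (i : Finset.range k) => ω i) = S := by
      funext ω
      refine hdep _ _ fun i hi => ?_
      simp [ext, hi]
    rwa [he] at this
  have hek : Measurable fun ω : RandomTape => ω k := measurable_pi_apply k
  have hlaw := (indepFun_iff_map_prod_eq_prod_map_map hS.aemeasurable hek.aemeasurable).1 hind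
  have hgu : Measurable (Function.uncurry g) := measurable_from_prod_countable_right hg
  have hmk : tapeMeasure.map (fun ω : RandomTape => ω k) = volume :=
    Measure.infinitePi_map_eval _ k
  calc _ = ∫⁻ p, Function.uncurry g p ∂(tapeMeasure.map fun ω => (S ω, ω k)) :=
        (lintegral_map hgu (hS.prodMk hek)).symm
    _ = ∫⁻ a, (∫⁻ u, g a u) ∂(tapeMeasure.map S) := by
        rw [hlaw, hmk, lintegral_prod _ hgu.aemeasurable]
        rfl
    _ = _ := lintegral_map (Measurable.of_discrete) hS

/-- The index that is drawn below `n` with the help of the random number `u`. -/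
noncomputable def drawIndex (n : ℕ) (u : unitInterval) : ℕ := ⌊(u : ℝ) * (n : ℝ)⌋₊

theorem measurable_drawIndex (n : ℕ) : Measurable (drawIndex n) :=
  Nat.measurable_floor.comp (measurable_subtype_coe.mul_const _)

theorem volume_drawIndex_eq {n : ℕ} (i : Fin n) :
    volume {u | drawIndex n u = (i : ℕ)} = (n : ℝ≥0∞)⁻¹ := by
  have hn : (0 : ℝ) < n := by exact_mod_cast i.pos
  have hi : ((i : ℕ) : ℝ) + 1 ≤ n := by exact_mod_cast i.2
  have himg : Subtype.val '' {u | drawIndex n u = (i : ℕ)} =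
      Ico ((i : ℝ) / n) (((i : ℝ) + 1) / n) := by
    ext x
    constructor
    · rintro ⟨u, hu, rfl⟩
      have h := (Nat.floor_eq_iff (mul_nonneg u.2.1 hn.le)).1 hu
      exact ⟨(div_le_iff₀ hn).2 h.1, (lt_div_iff₀ hn).2 h.2⟩
    · rintro ⟨h1, h2⟩
      have h0 : 0 ≤ x := le_trans (by positivity) h1
      have hx1 : x ≤ 1 := h2.le.trans ((div_le_one hn).2 hi)
      exact ⟨⟨x, h0, hx1⟩, (Nat.floor_eq_iff (mul_nonneg h0 hn.le)).2
        ⟨(div_le_iff₀ hn).1 h1, (lt_div_iff₀ hn).1 h2⟩, rfl⟩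
  rw [Measure.Subtype.volume_def, comap_subtype_coe_apply measurableSet_Icc, himg, Real.volume_Ico,
    ← sub_div, add_sub_cancel_left, ENNReal.ofReal_div_of_pos hn, ENNReal.ofReal_one,
    ENNReal.ofReal_natCast, one_div]

theorem mul_sum_le_lintegral_drawIndex (n : ℕ) (f : ℕ → ℝ≥0∞) :
    (n : ℝ≥0∞)⁻¹ * ∑ i : Fin n, f i ≤ ∫⁻ u, f (drawIndex n u) := by
  have hm : ∀ i : Fin n, MeasurableSet {u | drawIndex n u = (i : ℕ)} := fun i =>
    measurable_drawIndex n (measurableSet_singleton _)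
  calc _ = ∑ i : Fin n, ∫⁻ u, {u | drawIndex n u = (i : ℕ)}.indicator (fun _ => f i) u := by
        rw [Finset.mul_sum]
        refine Finset.sum_congr rfl fun i _ => ?_
        rw [lintegral_indicator_const (hm i), volume_drawIndex_eq, mul_comm]
    _ = ∫⁻ u, ∑ i : Fin n, {u | drawIndex n u = (i : ℕ)}.indicator (fun _ => f i) u := by
        rw [lintegral_finsetSum]
        exact fun i _ => measurable_const.indicator (hm i)
    _ ≤ _ := by
        refine lintegral_mono fun u => ?_
        by_cases h : ∃ i : Fin n, drawIndex n u = i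
        · obtain ⟨i, hi⟩ := h
          rw [Finset.sum_eq_single i]
          · rw [hi]
            exact Set.indicator_le_self' (fun _ _ => zero_le) _
          · intro j _ hj
            refine Set.indicator_of_notMem (fun hu => hj (Fin.ext ?_)) _
            exact (show drawIndex n u = j from hu).symm.trans hi
          · simp
        · push Not at h
          exact (Finset.sum_eq_zero fun i _ => Set.indicator_of_notMem (h i) _).trans_le zero_le

theorem ofReal_mean_le_lintegral_drawIndex (n : ℕ) {f : ℕ → ℕ → ℝ}
    (hf : ∀ i j, 0 ≤ f i j) :
    ENNReal.ofReal ((∑ i : Fin n, ∑ j : Fin n, f i j) / (n : ℝ) ^ 2) ≤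
      ∫⁻ u₁, ∫⁻ u₂, ENNReal.ofReal (f (drawIndex n u₁) (drawIndex n u₂)) := by
  rcases n.eq_zero_or_pos with rfl | hn
  · simp
  have hn' : (0 : ℝ) < n := by exact_mod_cast hn
  calc _ = (n : ℝ≥0∞)⁻¹ * ENNReal.ofReal (∑ i : Fin n, (∑ j : Fin n, f i j) / n) := by
        rw [← Finset.sum_div, sq, ← div_div, div_eq_inv_mul _ (n : ℝ), ENNReal.ofReal_mul
          (by positivity), ENNReal.ofReal_inv_of_pos hn', ENNReal.ofReal_natCast]
    _ ≤ (n : ℝ≥0∞)⁻¹ * ∑ i : Fin n, (n : ℝ≥0∞)⁻¹ * ∑ j : Fin n, ENNReal.ofReal (f i j) := by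
        rw [ENNReal.ofReal_sum_of_nonneg fun (i : Fin n) _ =>
          div_nonneg (Finset.sum_nonneg fun (j : Fin n) _ => hf i j) hn'.le]
        refine mul_le_mul_right (Finset.sum_le_sum fun i _ => le_of_eq ?_) _
        rw [div_eq_inv_mul, ENNReal.ofReal_mul (by positivity), ENNReal.ofReal_inv_of_pos hn',
          ENNReal.ofReal_natCast, ENNReal.ofReal_sum_of_nonneg fun (j : Fin n) _ => hf i j]
    _ ≤ (n : ℝ≥0∞)⁻¹ * ∑ i : Fin n, ∫⁻ u₂, ENNReal.ofReal (f i (drawIndex n u₂)) :=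
        mul_le_mul_right (Finset.sum_le_sum fun (i : Fin n) _ =>
          mul_sum_le_lintegral_drawIndex n fun j => ENNReal.ofReal (f i j)) _
    _ ≤ _ := mul_sum_le_lintegral_drawIndex n
        fun i => ∫⁻ u₂, ENNReal.ofReal (f i (drawIndex n u₂))

section Labels
variable {d n : ℕ} (B : Fin n → EuclideanBall d)

/-- The labels after `k` rounds. -/
noncomputable def labels (ω : RandomTape) : ℕ → Fin n → ℕ
  | 0 => fun _ => 0
  | k + 1 => relabel (labels ω k)
      (sides B (drawIndex n (ω (3 * k))) (drawIndex n (ω (3 * k + 1))) (ω (3 * k + 2)))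

theorem isSeparating_labels (ω : RandomTape) (k : ℕ) : IsSeparating B (labels B ω k) := by
  induction k with
  | zero => exact isSeparating_zero B
  | succ k ih => exact ih.relabel B _ _ _

theorem labels_congr {ω ω' : RandomTape} {k : ℕ} (h : ∀ i < 3 * k, ω i = ω' i) :
    labels B ω k = labels B ω' k := by
  induction k with
  | zero => rfl
  | succ k ih =>
    rw [labels, labels, ih fun i hi => h i (by omega), h (3 * k) (by omega),
      h (3 * k + 1) (by omega), h (3 * k + 2) (by omega)]

theorem measurable_relabel_sides (A : Fin n → ℕ) (q q' : ℕ) :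
    Measurable fun u => relabel A (sides B q q' u) :=
  (Measurable.of_discrete (f := relabel A)).comp (measurable_sides B q q')

theorem measurable_labels (k : ℕ) : Measurable fun ω => labels B ω k := by
  induction k with
  | zero => exact measurable_const
  | succ k ih =>
    have h : Measurable fun p : ((Fin n → ℕ) × ℕ × ℕ) × unitInterval =>
        relabel p.1.1 (sides B p.1.2.1 p.1.2.2 p.2) :=
      measurable_from_prod_countable_right fun a => measurable_relabel_sides B a.1 a.2.1 a.2.2
    have hd := measurable_drawIndex n
    have h₁ : Measurable fun ω : RandomTape => drawIndex n (ω (3 * k)) :=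
      hd.comp (measurable_pi_apply _)
    have h₂ : Measurable fun ω : RandomTape => drawIndex n (ω (3 * k + 1)) :=
      hd.comp (measurable_pi_apply _)
    have h₃ : Measurable fun ω : RandomTape => ω (3 * k + 2) := measurable_pi_apply _
    exact h.comp ((ih.prodMk (h₁.prodMk h₂)).prodMk h₃)

/-- The mean of a function of the labels after a round that starts with the labels `A`. -/
noncomputable def roundMean (g : (Fin n → ℕ) → ℝ≥0∞) (A : Fin n → ℕ) : ℝ≥0∞ :=
  ∫⁻ u₁, ∫⁻ u₂, ∫⁻ u₃, g (relabel A (sides B (drawIndex n u₁) (drawIndex n u₂) u₃))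

theorem lintegral_labels_succ (g : (Fin n → ℕ) → ℝ≥0∞) (k : ℕ) :
    ∫⁻ ω, g (labels B ω (k + 1)) ∂tapeMeasure =
      ∫⁻ ω, roundMean B g (labels B ω k) ∂tapeMeasure := by
  have hd := measurable_drawIndex n
  have hl := measurable_labels B k
  have hdi : ∀ i, Measurable fun ω : RandomTape => drawIndex n (ω i) := fun i =>
    hd.comp (measurable_pi_apply i)
  have h₃ := lintegral_next (3 * k + 2)
    (S := fun ω => (labels B ω k, drawIndex n (ω (3 * k)), drawIndex n (ω (3 * k + 1))))
    (g := fun s u => g (relabel s.1 (sides B s.2.1 s.2.2 u)))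
    (hl.prodMk ((hdi _).prodMk (hdi _)))
    (fun ω ω' h => by
      rw [labels_congr B fun i hi => h i (by omega), h (3 * k) (by omega),
        h (3 * k + 1) (by omega)])
    (fun s => Measurable.of_discrete.comp (measurable_relabel_sides B _ _ _))
  have h₂ := lintegral_next (3 * k + 1)
    (S := fun ω => (labels B ω k, drawIndex n (ω (3 * k))))
    (g := fun s u => ∫⁻ u₃, g (relabel s.1 (sides B s.2 (drawIndex n u) u₃)))
    (hl.prodMk (hdi _))
    (fun ω ω' h => by
      rw [labels_congr B fun i hi => h i (by omega), h (3 * k) (by omega)])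
    (fun s => (Measurable.of_discrete
      (f := fun q' => ∫⁻ u₃, g (relabel s.1 (sides B s.2 q' u₃)))).comp hd)
  have h₁ := lintegral_next (3 * k) (S := fun ω => labels B ω k)
    (g := fun s u => ∫⁻ u₂, ∫⁻ u₃, g (relabel s (sides B (drawIndex n u) (drawIndex n u₂) u₃)))
    hl (fun ω ω' h => labels_congr B h)
    (fun s => (Measurable.of_discrete
      (f := fun q => ∫⁻ u₂, ∫⁻ u₃, g (relabel s (sides B q (drawIndex n u₂) u₃)))).comp hd)
  exact h₃.trans (h₂.trans h₁)

/-! ### The size of the separator -/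

theorem lintegral_card_separator_le (hd : 2 ≤ d) (k : ℕ) :
    ∫⁻ ω, ((Finset.univ.filter fun i => labels B ω k i = 1).card : ℝ≥0∞) ∂tapeMeasure ≤
      k * ENNReal.ofReal (12 * separatorBound B) := by
  induction k with
  | zero => simp [labels]
  | succ k ih =>
    rw [lintegral_labels_succ B (fun A => ((Finset.univ.filter fun i => A i = 1).card : ℝ≥0∞)) k,
      Nat.cast_succ, add_mul, one_mul]
    refine le_trans ?_ (add_le_add_left ih _)
    rw [← one_mul (ENNReal.ofReal _), ← measure_univ (μ := tapeMeasure), mul_comm,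
      ← lintegral_const, ← lintegral_add_right _ measurable_const]
    refine lintegral_mono fun ω => ?_
    have h₃ : ∀ q q', ∫⁻ u₃, ((Finset.univ.filter fun i =>
        relabel (labels B ω k) (sides B q q' u₃) i = 1).card : ℝ≥0∞) ≤
        (Finset.univ.filter fun i => labels B ω k i = 1).card +
          ENNReal.ofReal (12 * separatorBound B) := by
      intro q q'
      refine le_trans (lintegral_mono (g := fun u₃ =>
        ((Finset.univ.filter fun i => labels B ω k i = 1).card : ℝ≥0∞) +
          (Finset.univ.filter fun i => sides B q q' u₃ i = 1).card) fun u => ?_) ?_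
      · dsimp only
        rw [← Nat.cast_add]
        exact Nat.cast_le.2 (card_separator_relabel_le _ _)
      · rw [lintegral_add_left measurable_const, lintegral_const, measure_univ, mul_one]
        gcongr
        exact lintegral_card_sides_le B hd q q'
    have h₂ : ∀ c : ℝ≥0∞, ∫⁻ _ : unitInterval, c = c := fun c => by
      rw [lintegral_const, measure_univ, mul_one]
    refine le_trans (lintegral_mono fun u₁ => ?_) (h₂ _).le
    exact le_trans (lintegral_mono fun u₂ => h₃ _ _) (h₂ _).le

/-! ### Balance -/

theorem card_active_add_progress_le {A : Fin n → ℕ} {q q' : Fin n}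
    (h : 3 * ((Finset.univ.filter fun i => A i = 0).filter fun i =>
      dist (B i).center (B q).center < 2 * dist (B q).center (B q').center).card ≤ 2 * n)
    {W : Finset (Fin n)} (hW : ∀ i ∈ W, A i = 0) (u : unitInterval) :
    (Finset.univ.filter fun i => relabel A (sides B q q' u) i = 0).card +
      (W.filter fun i => dist (B i).center (B q).center ≤ dist (B q').center (B q).center).card ≤
      (Finset.univ.filter fun i => A i = 0).card := by
  refine card_active_relabel_add_le (le_trans (Nat.mul_le_mul_left 3
    (Finset.card_le_card fun i hi => ?_)) h) fun i hi => ?_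
  · simp only [Finset.mem_filter, Finset.mem_univ, true_and, sides, side_eq_two, ctr_val] at hi ⊢
    exact ⟨hi.1, hi.2.2.trans_le (sphereRadius_le dist_nonneg u)⟩
  · rw [Finset.mem_filter] at hi
    refine ⟨hW i hi.1, fun h0 => ?_⟩
    rw [sides, side_eq_zero (B i).radius_pos, ctr_val, ctr_val] at h0
    have := le_sphereRadius (r := dist (B q).center (B q').center) dist_nonneg u
    have := (B i).radius_pos
    linarith [hi.2, dist_comm (B q).center (B q').center]

theorem roundMean_card_active_le (A : Fin n → ℕ) :
    roundMean B (fun A => ((Finset.univ.filter fun i => A i = 0).card : ℝ≥0∞)) A ≤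
      (Finset.univ.filter fun i => A i = 0).card := by
  have h₂ : ∀ c : ℝ≥0∞, ∫⁻ _ : unitInterval, c = c := fun c => by
    rw [lintegral_const, measure_univ, mul_one]
  refine le_trans (lintegral_mono fun u₁ => le_trans (lintegral_mono fun u₂ => le_trans
    (lintegral_mono fun u₃ => ?_) (h₂ _).le) (h₂ _).le) (h₂ _).le
  exact Nat.cast_le.2 (card_active_relabel_le _ _)

/-- As long as many balls are active, a round splits off a constant fraction in the mean. -/
theorem roundMean_card_active_add_le {K : ℕ} (hK0 : 0 < K)
    (hK : ∀ (x : EuclideanSpace ℝ (Fin d)) (r : ℝ), 0 < r →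
      ∃ t : Finset (EuclideanSpace ℝ (Fin d)),
        t.card ≤ K ∧ ball x (4 * r) ⊆ ⋃ y ∈ t, ball y (r / 4))
    (hn : 0 < n) {A : Fin n → ℕ} (hA : 2 * n < 3 * (Finset.univ.filter fun i => A i = 0).card) :
    roundMean B (fun A => ((Finset.univ.filter fun i => A i = 0).card : ℝ≥0∞)) A +
      ENNReal.ofReal (4 * n / (27 * K ^ 3)) ≤ (Finset.univ.filter fun i => A i = 0).card := by
  classical
  set V := Finset.univ.filter fun i => A i = 0 with hVdef
  have hn' : (0 : ℝ) < n := by exact_mod_cast hn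
  have hK' : (0 : ℝ) < K := by exact_mod_cast hK0
  have hK1 : (1 : ℝ) ≤ K := by exact_mod_cast hK0
  set μ : ℝ := 2 * n / (3 * K) with hμdef
  have hμ : 0 < μ := by positivity
  have hKμ : 3 * (K * μ) = 2 * n := by rw [hμdef]; field_simp
  have hμV : μ ≤ V.card := by
    have : (2 : ℝ) * n < 3 * V.card := by exact_mod_cast hA
    nlinarith
  obtain ⟨Q, W, hQV, hQc, hW⟩ := exists_good_pairs (fun i => (B i).center) V hK hμ hμV
  let prog : Fin n → Fin n → ℕ := fun q q' => if q ∈ Q ∧ q' ∈ W q then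
    ((W q).filter fun i => dist (B i).center (B q).center ≤ dist (B q').center (B q).center).card
    else 0
  let prog' : ℕ → ℕ → ℕ := fun q q' =>
    if h : q < n ∧ q' < n then prog ⟨q, h.1⟩ ⟨q', h.2⟩ else 0
  have hprog : ∀ q q' u, (Finset.univ.filter fun i => relabel A (sides B q q' u) i = 0).card +
      prog' q q' ≤ V.card := by
    intro q q' u
    by_cases h : q < n ∧ q' < n
    · by_cases hq : (⟨q, h.1⟩ : Fin n) ∈ Q ∧ (⟨q', h.2⟩ : Fin n) ∈ W ⟨q, h.1⟩
      · obtain ⟨h1, h2, h3⟩ := hW _ hq.1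
        simp only [prog', dif_pos h, prog, if_pos hq]
        refine card_active_add_progress_le B (q := ⟨q, h.1⟩) (q' := ⟨q', h.2⟩) ?_
          (fun i hi => by simpa [hVdef] using h1 hi) u
        have := h3 _ hq.2
        have : (3 : ℝ) * ((V.filter fun i => dist (B i).center (B ⟨q, h.1⟩).center <
            2 * dist (B ⟨q, h.1⟩).center (B ⟨q', h.2⟩).center).card : ℝ) ≤ 2 * n := by
          linarith
        exact_mod_cast this
      · simp only [prog', dif_pos h, prog, if_neg hq, add_zero]
        exact card_active_relabel_le _ _
    · simp only [prog', dif_neg h, add_zero]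
      exact card_active_relabel_le _ _
  have hsum : μ ^ 3 ≤ 2 * ∑ q, ∑ q', (prog q q' : ℝ) := by
    have h1 : ∀ q ∈ Q, μ ^ 2 ≤ 2 * ∑ q', (prog q q' : ℝ) := by
      intro q hq
      have h2 := card_sq_le_sum_card_filter_le (W q) fun i => dist (B i).center (B q).center
      have h3 : ∑ q', (prog q q' : ℝ) = ∑ q' ∈ W q, (((W q).filter fun i =>
          dist (B i).center (B q).center ≤ dist (B q').center (B q).center).card : ℝ) := by
        simp [prog, hq, Finset.sum_ite_mem]
      rw [h3]
      have h4 : ((W q).card : ℝ) ^ 2 ≤ 2 * ∑ q' ∈ W q, (((W q).filter fun i =>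
          dist (B i).center (B q).center ≤ dist (B q').center (B q).center).card : ℝ) := by
        exact_mod_cast h2
      exact (pow_le_pow_left₀ hμ.le (hW q hq).2.1 2).trans h4
    calc μ ^ 3 = μ * μ ^ 2 := by ring
      _ ≤ Q.card * μ ^ 2 := by gcongr
      _ = ∑ q ∈ Q, μ ^ 2 := by rw [Finset.sum_const, nsmul_eq_mul]
      _ ≤ ∑ q ∈ Q, 2 * ∑ q', (prog q q' : ℝ) := Finset.sum_le_sum h1
      _ = 2 * ∑ q ∈ Q, ∑ q', (prog q q' : ℝ) := by rw [Finset.mul_sum]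
      _ ≤ 2 * ∑ q, ∑ q', (prog q q' : ℝ) :=
        mul_le_mul_of_nonneg_left (Finset.sum_le_sum_of_subset_of_nonneg (Finset.subset_univ Q)
          fun _ _ _ => Finset.sum_nonneg fun _ _ => Nat.cast_nonneg _) zero_le_two
  have hint : ENNReal.ofReal (4 * n / (27 * K ^ 3)) ≤
      ∫⁻ u₁, ∫⁻ u₂, ∫⁻ _ : unitInterval,
        ENNReal.ofReal (prog' (drawIndex n u₁) (drawIndex n u₂) : ℝ) := by
    have h₃ : ∀ c : ℝ≥0∞, ∫⁻ _ : unitInterval, c = c := fun c => by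
      rw [lintegral_const, measure_univ, mul_one]
    simp only [h₃]
    have hval : ∀ q q' : Fin n, prog' q q' = prog q q' := fun q q' => by simp [prog']
    refine le_trans (ENNReal.ofReal_le_ofReal ?_)
      (ofReal_mean_le_lintegral_drawIndex n (f := fun q q' => (prog' q q' : ℝ))
        fun _ _ => Nat.cast_nonneg _)
    simp only [hval]
    have : μ ^ 3 = 2 * (4 * n / (27 * K ^ 3) * n ^ 2) := by
      rw [hμdef]; field_simp; ring
    rw [le_div_iff₀ (by positivity)]
    linarith
  have h₂ : ∀ c : ℝ≥0∞, ∫⁻ _ : unitInterval, c = c := fun c => by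
    rw [lintegral_const, measure_univ, mul_one]
  refine (add_le_add_right hint _).trans ((le_lintegral_add _ _).trans ?_)
  refine le_trans (lintegral_mono fun u₁ => ?_) (h₂ _).le
  refine (le_lintegral_add _ _).trans (le_trans (lintegral_mono fun u₂ => ?_) (h₂ _).le)
  refine (le_lintegral_add _ _).trans (le_trans (lintegral_mono fun u₃ => ?_) (h₂ _).le)
  dsimp only
  rw [ENNReal.ofReal_natCast, ← Nat.cast_add]
  exact Nat.cast_le.2 (hprog _ _ _)

theorem card_active_labels_anti (ω : RandomTape) {k l : ℕ} (h : k ≤ l) :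
    (Finset.univ.filter fun i => labels B ω l i = 0).card ≤
      (Finset.univ.filter fun i => labels B ω k i = 0).card := by
  induction l, h using Nat.le_induction with
  | base => exact le_rfl
  | succ l _ ih => exact (card_active_relabel_le _ _).trans ih

theorem measure_unbalanced_le {K : ℕ} (hK0 : 0 < K)
    (hK : ∀ (x : EuclideanSpace ℝ (Fin d)) (r : ℝ), 0 < r →
      ∃ t : Finset (EuclideanSpace ℝ (Fin d)),
        t.card ≤ K ∧ ball x (4 * r) ⊆ ⋃ y ∈ t, ball y (r / 4))
    (hn : 0 < n) :
    tapeMeasure {ω | 2 * n < 3 * (Finset.univ.filter fun i =>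
      labels B ω (27 * K ^ 3) i = 0).card} ≤ 1 / 4 := by
  set J := 27 * K ^ 3 with hJ
  set E := {ω | 2 * n < 3 * (Finset.univ.filter fun i => labels B ω J i = 0).card} with hE
  set a := ENNReal.ofReal (4 * n / (27 * K ^ 3)) with ha
  have hEm : MeasurableSet E := by
    have := (measurable_labels B J) (MeasurableSet.of_discrete
      (s := {A | 2 * n < 3 * (Finset.univ.filter fun i => A i = 0).card}))
    exact this
  have hind : ∀ k ≤ J, ∫⁻ ω, ((Finset.univ.filter fun i => labels B ω k i = 0).card : ℝ≥0∞)
      ∂tapeMeasure + k * (a * tapeMeasure E) ≤ n := by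
    intro k hk
    induction k with
    | zero => simp [labels]
    | succ k ih =>
      refine le_trans ?_ (ih (by omega))
      rw [lintegral_labels_succ B (fun A => ((Finset.univ.filter fun i => A i = 0).card : ℝ≥0∞)) k,
        Nat.cast_succ, add_mul, one_mul, add_comm (_ * _), ← add_assoc,
        ← lintegral_indicator_const hEm]
      refine add_le_add_left ((le_lintegral_add _ _).trans (lintegral_mono fun ω => ?_)) _
      by_cases hω : ω ∈ E
      · rw [Set.indicator_of_mem hω]
        refine roundMean_card_active_add_le B hK0 hK hn (lt_of_lt_of_le hω ?_)
        exact Nat.mul_le_mul_left 3 (card_active_labels_anti B ω (by omega))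
      · rw [Set.indicator_of_notMem hω, add_zero]
        exact roundMean_card_active_le B _
  have h := le_trans le_add_self (hind J le_rfl)
  have hJa : (J : ℝ≥0∞) * a = 4 * n := by
    have hK' : (0 : ℝ) < K := by exact_mod_cast hK0
    rw [ha, ← ENNReal.ofReal_natCast J, ← ENNReal.ofReal_mul (by positivity), hJ]
    push_cast
    rw [mul_div_cancel₀ _ (by positivity), ENNReal.ofReal_mul (by norm_num)]
    simp
  rw [← mul_assoc, hJa, mul_comm (4 : ℝ≥0∞), mul_assoc] at h
  have hn0 : (n : ℝ≥0∞) ≠ 0 := by exact_mod_cast hn.ne'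
  have h4 : 4 * tapeMeasure E ≤ 1 := by
    rwa [← ENNReal.mul_le_mul_iff_right hn0 (ENNReal.natCast_ne_top n), mul_one]
  rw [ENNReal.le_div_iff_mul_le (by norm_num) (by norm_num), mul_comm]
  exact h4

theorem one_le_separatorBound (hd : 2 ≤ d) (hn : 0 < n) : 1 ≤ separatorBound B := by
  simpa using card_le_separatorBound B hd (I := {⟨0, hn⟩}) (x := (B ⟨0, hn⟩).center)
    (by simpa using center_mem_carrier (B ⟨0, hn⟩))

/-- With probability at least one half, the balls with the label `1` form a balanced separator of
the required size. -/
theorem half_le_measure_labels (hd : 2 ≤ d) {K : ℕ} (hK0 : 0 < K)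
    (hK : ∀ (x : EuclideanSpace ℝ (Fin d)) (r : ℝ), 0 < r →
      ∃ t : Finset (EuclideanSpace ℝ (Fin d)),
        t.card ≤ K ∧ ball x (4 * r) ⊆ ⋃ y ∈ t, ball y (r / 4))
    (hn : 0 < n) :
    1 / 2 ≤ tapeMeasure {ω | 3 * (Finset.univ.filter fun i =>
        labels B ω (27 * K ^ 3) i = 0).card ≤ 2 * n ∧
      ((Finset.univ.filter fun i => labels B ω (27 * K ^ 3) i = 1).card : ℝ) ≤
        48 * (27 * K ^ 3 : ℕ) * separatorBound B} := by
  have hS := one_le_separatorBound B hd hn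
  set J := 27 * K ^ 3 with hJ
  have hJ0 : (0 : ℝ) < J := by
    have : (0 : ℝ) < K := by exact_mod_cast hK0
    rw [hJ]
    push_cast
    positivity
  set c : ℝ≥0∞ := J * ENNReal.ofReal (12 * separatorBound B) with hc
  have hc' : c = ENNReal.ofReal (J * (12 * separatorBound B)) := by
    rw [hc, ENNReal.ofReal_mul hJ0.le, ENNReal.ofReal_natCast]
  have hc0 : c ≠ 0 := by
    rw [hc', Ne, ENNReal.ofReal_eq_zero, not_le]
    positivity
  have hct : c ≠ ∞ := hc' ▸ ENNReal.ofReal_ne_top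
  set E₁ := {ω | 2 * n < 3 * (Finset.univ.filter fun i => labels B ω J i = 0).card}
  set E₂ := {ω | 4 * c ≤ ((Finset.univ.filter fun i => labels B ω J i = 1).card : ℝ≥0∞)} with hE₂
  have h₁ : tapeMeasure E₁ ≤ 1 / 4 := measure_unbalanced_le B hK0 hK hn
  have h₂ : tapeMeasure E₂ ≤ 1 / 4 := by
    have hm : Measurable fun ω =>
        ((Finset.univ.filter fun i => labels B ω J i = 1).card : ℝ≥0∞) :=
      (Measurable.of_discrete
        (f := fun A : Fin n → ℕ => ((Finset.univ.filter fun i => A i = 1).card : ℝ≥0∞))).comp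
        (measurable_labels B J)
    have h := (mul_meas_ge_le_lintegral (μ := tapeMeasure) hm (4 * c)).trans
      (lintegral_card_separator_le B hd J)
    rw [← hc, mul_comm (4 : ℝ≥0∞) c, mul_assoc, mul_comm c 4] at h
    have h4 : 4 * tapeMeasure E₂ ≤ 1 := by
      rwa [← ENNReal.mul_le_mul_iff_right hc0 hct, mul_one]
    rw [ENNReal.le_div_iff_mul_le (by norm_num) (by norm_num), mul_comm]
    exact h4
  have hcompl : (E₁ ∪ E₂)ᶜ ⊆ {ω | 3 * (Finset.univ.filter fun i =>
        labels B ω J i = 0).card ≤ 2 * n ∧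
      ((Finset.univ.filter fun i => labels B ω J i = 1).card : ℝ) ≤
        48 * (J : ℕ) * separatorBound B} := by
    intro ω hω
    rw [Set.mem_compl_iff, Set.mem_union, not_or] at hω
    refine ⟨not_lt.1 hω.1, ?_⟩
    have h := (not_le.1 (show ¬ 4 * c ≤ _ from hω.2)).le
    have e : 4 * c = ENNReal.ofReal (48 * J * separatorBound B) := by
      rw [hc', show (4 : ℝ≥0∞) = ENNReal.ofReal 4 by norm_num, ← ENNReal.ofReal_mul (by norm_num)]
      congr 1
      ring
    rw [e, ← ENNReal.ofReal_natCast] at h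
    exact (ENNReal.ofReal_le_ofReal_iff (by positivity)).1 h
  refine le_trans ?_ (measure_mono hcompl)
  have hle : tapeMeasure (E₁ ∪ E₂) ≤ 1 / 2 := by
    refine (measure_union_le _ _).trans ((add_le_add h₁ h₂).trans (le_of_eq ?_))
    rw [← ENNReal.toReal_eq_toReal_iff' (by finiteness) (by finiteness)]
    rw [ENNReal.toReal_add (by finiteness) (by finiteness)]
    norm_num
  have huniv : (1 : ℝ≥0∞) ≤ tapeMeasure (E₁ ∪ E₂) + tapeMeasure (E₁ ∪ E₂)ᶜ := by
    have := measure_union_le (μ := tapeMeasure) (E₁ ∪ E₂) (E₁ ∪ E₂)ᶜ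
    rwa [Set.union_compl_self, measure_univ] at this
  have hsplit : (1 / 2 : ℝ≥0∞) + 1 / 2 ≤ 1 / 2 + tapeMeasure (E₁ ∪ E₂)ᶜ := by
    rw [ENNReal.add_halves]
    exact huniv.trans (add_le_add_left hle _)
  exact (ENNReal.add_le_add_iff_left (by finiteness)).1 hsplit

end Labels
end BallSeparator

namespace BallSeparator

/-! ### Running programs -/

/-- The program `P`, started in the state `s`, halts after at most `T` steps in a state with the
property `Q`. -/
def Runs (ω : RandomTape) (P : Program) (s : State) (Q : State → Prop) (T : ℕ) : Prop :=
  ∃ s' t, Exec ω P s s' t ∧ t ≤ T ∧ Q s'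

namespace Runs
variable {ω : RandomTape} {P P' : Program} {s : State} {Q Q' : State → Prop} {T T' : ℕ}

theorem mono (h : Runs ω P s Q T) (hQ : ∀ s', Q s' → Q' s') (hT : T ≤ T') : Runs ω P s Q' T' := by
  obtain ⟨s', t, he, ht, hq⟩ := h
  exact ⟨s', t, he, ht.trans hT, hQ _ hq⟩

theorem skip (h : Q s) : Runs ω .skip s Q 1 := ⟨s, 1, .skip s, le_rfl, h⟩

theorem instr {c : Instr} (h : Q (c.eval ω s)) : Runs ω (.instr c) s Q 1 :=
  ⟨_, 1, .instr c s, le_rfl, h⟩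

theorem seq (h : Runs ω P s Q' T) (h' : ∀ s', Q' s' → Runs ω P' s' Q T') :
    Runs ω (.seq P P') s Q (T + T') := by
  obtain ⟨s', t, he, ht, hq⟩ := h
  obtain ⟨s'', t', he', ht', hq'⟩ := h' s' hq
  exact ⟨s'', t + t', .seq he he', by omega, hq'⟩

theorem ite {b : Test} (h : b.holds s → Runs ω P s Q T) (h' : ¬ b.holds s → Runs ω P' s Q T) :
    Runs ω (.ite b P P') s Q (T + 1) := by
  by_cases hb : b.holds s
  · obtain ⟨s', t, he, ht, hq⟩ := h hb
    exact ⟨s', t + 1, .iteTrue hb he, by omega, hq⟩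
  · obtain ⟨s', t, he, ht, hq⟩ := h' hb
    exact ⟨s', t + 1, .iteFalse hb he, by omega, hq⟩

/-- Counting loops. -/
theorem forLoop {I : ℕ → State → Prop} {n i₀ i₁ : ℕ}
    (hI : ∀ i s, I i s → s.natReg i₀ = i ∧ s.natReg i₁ = n)
    (hP : ∀ i < n, ∀ s, I i s → Runs ω P s (I (i + 1)) T) (h0 : I 0 s) :
    Runs ω (.loop (.natLt i₀ i₁) P) s (I n) (n * (T + 1) + 1) := by
  have key : ∀ k ≤ n, ∀ s, I (n - k) s →
      Runs ω (.loop (.natLt i₀ i₁) P) s (I n) (k * (T + 1) + 1) := by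
    intro k
    induction k with
    | zero =>
      intro _ s hs
      have := hI _ _ hs
      refine ⟨s, 1, .loopFalse ?_, by omega, hs⟩
      simp only [Test.holds]
      omega
    | succ k ih =>
      intro hk s hs
      have := hI _ _ hs
      obtain ⟨s', t, he, ht, hs'⟩ := hP (n - (k + 1)) (by omega) s hs
      rw [show n - (k + 1) + 1 = n - k by omega] at hs'
      obtain ⟨s'', t', he', ht', hs''⟩ := ih (by omega) s' hs'
      refine ⟨s'', _, .loopTrue ?_ he he', ?_, hs''⟩
      · simp only [Test.holds]
        omega
      · rw [add_mul]
        omega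
  exact key n le_rfl s (by simpa using h0)

end Runs

/-- A sequence of instructions. -/
def block : List Instr → Program
  | [] => .skip
  | c :: l => .seq (.instr c) (block l)

theorem Runs.block {ω : RandomTape} {l : List Instr} {s : State} {Q : State → Prop}
    (h : Q (l.foldl (fun s c => c.eval ω s) s)) : Runs ω (block l) s Q (l.length + 1) := by
  induction l generalizing s with
  | nil => exact Runs.skip h
  | cons c l ih =>
    refine (Runs.seq (Q' := fun s' => s' = c.eval ω s) (Runs.instr rfl) ?_).mono (fun _ h => h)
      (by simp [add_comm] : 1 + (l.length + 1) ≤ _)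
    rintro _ rfl
    exact ih h

/-! ### The program -/

/-- Stores in the real register `dst` the squared distance of the points with the indices in the
registers `x` and `y`, computed from the first `k` coordinates. -/
def sqDistProgram (dst x y : ℕ) : ℕ → Program
  | 0 => .instr (.realConst dst 0)
  | k + 1 => .seq (sqDistProgram dst x y k)
      (block [.realLoad 3 k x, .realLoad 4 k y, .realSub 3 3 4, .realMul 3 3 3, .realAdd dst dst 3])

/-- Stores in the register `4` the position of the ball with the index in the register `3`, with
respect to the sphere around the point with the index in the register `1`, whose squared radius is
in the real register `1`. -/
def sideProgram (d : ℕ) : Program :=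
  .seq (sqDistProgram 2 3 1 d) (.seq
    (block [.realLoad 3 d 3, .realMul 3 3 3, .realAdd 4 2 1, .realSub 4 4 3, .realMul 5 2 1,
      .realAdd 5 5 5, .realAdd 5 5 5, .realMul 6 4 4, .natConst 4 1])
    (.ite (.realLt 7 4)
      (.ite (.realLt 5 6)
        (.ite (.realLt 2 1) (.instr (.natConst 4 2)) (.instr (.natConst 4 0))) .skip) .skip))

/-- Counts the active balls inside the sphere (three times, in the register `6`) and all balls
(twice, in the register `7`). -/
def countProgram (d : ℕ) : Program :=
  .loop (.natLt 3 0) (.seq (sideProgram d) (.seq (.instr (.natLoad 5 0 3)) (.seq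
    (.ite (.natLt 5 8)
      (.ite (.natLt 8 4) (block [.natSucc 6 6, .natSucc 6 6, .natSucc 6 6]) .skip) .skip)
    (block [.natSucc 7 7, .natSucc 7 7, .natSucc 3 3]))))

/-- Replaces the labels of the active balls by their positions. -/
def updateProgram (d : ℕ) : Program :=
  .loop (.natLt 3 0) (.seq (sideProgram d) (.seq (.instr (.natLoad 5 0 3)) (.seq
    (.ite (.natLt 5 8) (.instr (.natStore 0 3 4)) .skip) (.instr (.natSucc 3 3)))))

/-- A round of the algorithm. -/
def roundProgram (d : ℕ) : Program :=
  .seq (block [.natConst 8 1, .realConst 7 0, .randIndex 1 0, .randIndex 2 0, .randReal 1])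
  (.seq (sqDistProgram 0 1 2 d)
  (.seq (block [.realConst 5 3, .realMul 1 1 5, .realConst 5 1, .realAdd 1 1 5, .realMul 1 1 0,
    .natConst 3 0, .natConst 6 0, .natConst 7 0])
  (.seq (countProgram d)
  (.ite (.natLt 7 6) .skip (.seq (.instr (.natConst 3 0)) (updateProgram d))))))

/-- The algorithm with `k` rounds. -/
def separatorProgram (d : ℕ) : ℕ → Program
  | 0 => .skip
  | k + 1 => .seq (separatorProgram d k) (roundProgram d)

/-! ### Correctness of the program -/

theorem runs_sqDistProgram (ω : RandomTape) {dst x y : ℕ} (h3 : dst ≠ 3) (h4 : dst ≠ 4) (k : ℕ)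
    (s : State) :
    Runs ω (sqDistProgram dst x y k) s (fun s' => ∃ f : ℕ → ℝ, s' = { s with realReg := f } ∧
      f dst = ∑ j ∈ Finset.range k,
        (s.realArr j (s.natReg x) - s.realArr j (s.natReg y)) ^ 2 ∧
      ∀ r, r ≠ dst → r ≠ 3 → r ≠ 4 → f r = s.realReg r) (6 * k + 1) := by
  induction k with
  | zero =>
    refine Runs.instr ⟨_, rfl, ?_, fun r hr _ _ => ?_⟩
    · simp
    · simp [hr]
  | succ k ih =>
    refine (Runs.seq ih (T' := 6) ?_).mono (fun _ h => h) (by omega)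
    rintro _ ⟨f, rfl, hf, hr⟩
    refine Runs.block ⟨_, rfl, ?_, fun r h0 h1 h2 => ?_⟩
    · simp [Instr.eval, State.setReal, h3, h4, hf, Finset.sum_range_succ, sq]
    · simp [Instr.eval, State.setReal, Function.update_apply, h0, h1, h2, hr]

/-- The position of a ball in terms of squared distances. -/
theorem side_eq_of_sq {D ρ R : ℝ} (hD : 0 ≤ D) (hρ : 0 < ρ) (hR : 0 ≤ R) :
    side D ρ R = if 0 < D ^ 2 + R ^ 2 - ρ ^ 2 then
      if 4 * (D ^ 2 * R ^ 2) < (D ^ 2 + R ^ 2 - ρ ^ 2) ^ 2 then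
        if D ^ 2 < R ^ 2 then 2 else 0 else 1 else 1 := by
  have hDR : 0 ≤ D * R := mul_nonneg hD hR
  have key : |D - R| ≤ ρ ↔ D ^ 2 + R ^ 2 - ρ ^ 2 ≤ 2 * (D * R) := by
    rw [← abs_of_pos hρ, ← sq_le_sq, abs_of_pos hρ]
    constructor <;> intro h <;> nlinarith
  have hlt : D ^ 2 < R ^ 2 ↔ D < R := sq_lt_sq₀ hD hR
  have h4 : 4 * (D ^ 2 * R ^ 2) = (2 * (D * R)) ^ 2 := by ring
  unfold side
  simp only [key, hlt, h4]
  by_cases he : 0 < D ^ 2 + R ^ 2 - ρ ^ 2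
  · have h5 : (2 * (D * R)) ^ 2 < (D ^ 2 + R ^ 2 - ρ ^ 2) ^ 2 ↔
        2 * (D * R) < D ^ 2 + R ^ 2 - ρ ^ 2 := sq_lt_sq₀ (by positivity) he.le
    simp only [if_pos he, h5]
    by_cases h : D ^ 2 + R ^ 2 - ρ ^ 2 ≤ 2 * (D * R)
    · rw [if_pos h, if_neg (not_lt.2 h)]
    · rw [if_neg h, if_pos (not_le.1 h)]
  · rw [if_neg he, if_pos (by linarith)]

section Correctness
variable {d n : ℕ} (B : Fin n → EuclideanBall d)

theorem sum_sq_sub_input (i j : ℕ) :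
    ∑ k ∈ Finset.range d, ((inputState B).realArr k i - (inputState B).realArr k j) ^ 2 =
      dist (ctr B i) (ctr B j) ^ 2 := by
  have h : ∀ (i : ℕ) (k : Fin d), (inputState B).realArr k i = ctr B i k := fun i k => by
    by_cases hi : i < n <;> simp [inputState, ctr, hi]
  rw [EuclideanSpace.dist_eq, Real.sq_sqrt (by positivity), Finset.sum_range]
  refine Finset.sum_congr rfl fun k _ => ?_
  rw [h, h, Real.dist_eq, sq_abs]

theorem radius_input (i : Fin n) : (inputState B).realArr d i = (B i).radius := by
  simp [inputState]

/-- The state during a round, in which the center of the sphere is the point `q` and the squared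
radius of the sphere is `w`. -/
structure InRound (q : ℕ) (w : ℝ) (k : ℕ) (s : State) : Prop where
  size : s.natReg 0 = n
  source : s.natReg 1 = q
  one : s.natReg 8 = 1
  input : s.realArr = (inputState B).realArr
  sqRadius : s.realReg 1 = w
  zero : s.realReg 7 = 0
  drawn : s.drawn = k

theorem runs_sideProgram (ω : RandomTape) {q k : ℕ} {R : ℝ} (hR : 0 ≤ R) {s : State}
    (hs : InRound B q (R ^ 2) k s) {i : Fin n} (hi : s.natReg 3 = i) :
    Runs ω (sideProgram d) s (fun s' => ∃ f : ℕ → ℝ,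
      s' = { s with
        realReg := f
        natReg := Function.update s.natReg 4 (side (dist (B i).center (ctr B q)) (B i).radius R) } ∧
      f 1 = R ^ 2 ∧ f 7 = 0) (6 * d + 15) := by
  refine (Runs.seq (runs_sqDistProgram ω (by norm_num) (by norm_num) d s) (T' := 14) ?_).mono
    (fun _ h => h) (by omega)
  rintro _ ⟨f, rfl, hf, hr⟩
  rw [hs.input, hi, hs.source, sum_sq_sub_input, ctr_val] at hf
  have hf1 : f 1 = R ^ 2 := (hr 1 (by norm_num) (by norm_num) (by norm_num)).trans hs.sqRadius
  have hf7 : f 7 = 0 := (hr 7 (by norm_num) (by norm_num) (by norm_num)).trans hs.zero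
  refine Runs.seq (T := 10) (T' := 4) (Q' := fun s' => ∃ g : ℕ → ℝ,
    s' = { s with realReg := g, natReg := Function.update s.natReg 4 1 } ∧ g 1 = R ^ 2 ∧ g 7 = 0 ∧
      g 2 = dist (B i).center (ctr B q) ^ 2 ∧
      g 4 = dist (B i).center (ctr B q) ^ 2 + R ^ 2 - (B i).radius ^ 2 ∧
      g 5 = 4 * (dist (B i).center (ctr B q) ^ 2 * R ^ 2) ∧ g 6 = g 4 ^ 2) ?_ ?_
  · refine Runs.block ⟨_, rfl, ?_⟩
    simp only [Instr.eval, State.setReal, Function.update_apply]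
    simp only [hf1, hf7, hf, hs.input, hi, radius_input]
    refine ⟨?_, ?_, ?_, ?_, ?_, ?_⟩ <;> norm_num <;> ring
  · rintro _ ⟨g, rfl, h1, h7, h2, h4, h5, h6⟩
    rw [side_eq_of_sq dist_nonneg (B i).radius_pos hR]
    refine Runs.ite (T := 3) (fun hb => Runs.ite (T := 2) (fun hb' => Runs.ite (T := 1)
      (fun hb'' => Runs.instr ⟨g, ?_, h1, h7⟩) (fun hb'' => Runs.instr ⟨g, ?_, h1, h7⟩))
      (fun hb' => (Runs.skip ⟨g, ?_, h1, h7⟩).mono (fun _ h => h) (by norm_num)))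
      (fun hb => (Runs.skip ⟨g, ?_, h1, h7⟩).mono (fun _ h => h) (by norm_num))
    all_goals simp only [Test.holds, h7, h4] at hb
    · simp only [Test.holds, h4, h5, h6, h1, h2] at hb' hb''
      simp only [hb, hb', hb'', if_true, Instr.eval, State.setNat, Function.update_idem]
    · simp only [Test.holds, h4, h5, h6, h1, h2] at hb' hb''
      simp only [hb, hb', hb'', if_true, if_false, Instr.eval, State.setNat, Function.update_idem]
    · simp only [Test.holds, h4, h5, h6] at hb'
      simp only [hb, hb', if_true, if_false]
    · simp only [hb, if_false]

theorem card_filter_lt_succ (p : Fin n → Prop) [DecidablePred p] (i : Fin n) :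
    (Finset.univ.filter fun j : Fin n => (j : ℕ) < i + 1 ∧ p j).card =
      (Finset.univ.filter fun j : Fin n => (j : ℕ) < i ∧ p j).card + if p i then 1 else 0 := by
  have h : (Finset.univ.filter fun j : Fin n => (j : ℕ) < i + 1 ∧ p j) =
      (Finset.univ.filter fun j : Fin n => (j : ℕ) < i ∧ p j) ∪ if p i then {i} else ∅ := by
    ext j
    have : (j : ℕ) < i + 1 ↔ (j : ℕ) < i ∨ j = i := by
      rw [Fin.ext_iff]
      omega
    by_cases hp : p i <;> simp only [Finset.mem_filter, Finset.mem_univ, true_and, this,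
      Finset.mem_union, hp, if_true, if_false, Finset.mem_singleton, Finset.notMem_empty, or_false]
    · constructor
      · rintro ⟨h | h, hj⟩
        · exact Or.inl ⟨h, hj⟩
        · exact Or.inr h
      · rintro (h | rfl)
        · exact ⟨Or.inl h.1, h.2⟩
        · exact ⟨Or.inr rfl, hp⟩
    · constructor
      · rintro ⟨h | rfl, hj⟩
        · exact ⟨h, hj⟩
        · exact absurd hj hp
      · exact fun h => ⟨Or.inl h.1, h.2⟩
  rw [h, Finset.card_union_of_disjoint]
  · split_ifs <;> simp
  · split_ifs <;> simp

theorem runs_countProgram (ω : RandomTape) {q k : ℕ} {R : ℝ} (hR : 0 ≤ R) {s : State}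
    (hs : InRound B q (R ^ 2) k s) {A : Fin n → ℕ} (hA : ∀ i : Fin n, s.natArr 0 i = A i)
    (h3 : s.natReg 3 = 0) (h6 : s.natReg 6 = 0) (h7 : s.natReg 7 = 0) :
    Runs ω (countProgram d) s (fun s' => InRound B q (R ^ 2) k s' ∧ s'.natArr = s.natArr ∧
      s'.natReg 6 = 3 * (Finset.univ.filter fun i => A i = 0 ∧
        side (dist (B i).center (ctr B q)) (B i).radius R = 2).card ∧
      s'.natReg 7 = 2 * n) (n * (6 * d + 27) + 1) := by
  have key := Runs.forLoop (ω := ω) (s := s) (n := n) (i₀ := 3) (i₁ := 0) (T := 6 * d + 26)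
    (I := fun i s' => InRound B q (R ^ 2) k s' ∧ s'.natArr = s.natArr ∧ s'.natReg 3 = i ∧
      s'.natReg 6 = 3 * (Finset.univ.filter fun j : Fin n => (j : ℕ) < i ∧ (A j = 0 ∧
        side (dist (B j).center (ctr B q)) (B j).radius R = 2)).card ∧
      s'.natReg 7 = 2 * i)
    (P := .seq (sideProgram d) (.seq (.instr (.natLoad 5 0 3)) (.seq
    (.ite (.natLt 5 8)
      (.ite (.natLt 8 4) (block [.natSucc 6 6, .natSucc 6 6, .natSucc 6 6]) .skip) .skip)
    (block [.natSucc 7 7, .natSucc 7 7, .natSucc 3 3]))))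
    (fun i s' h => ⟨h.2.2.1, h.1.size⟩) ?_ ⟨hs, rfl, h3, by simpa using h6, by simpa using h7⟩
  · refine key.mono (fun s' h => ⟨h.1, h.2.1, ?_, h.2.2.2.2⟩) le_rfl
    simpa using h.2.2.2.1
  · intro i hi s₁ h
    obtain ⟨hin, harr, hc3, hc6, hc7⟩ := h
    refine (Runs.seq (runs_sideProgram B ω hR hin (i := ⟨i, hi⟩) hc3) (T' := 11) ?_).mono
      (fun _ h => h) (by omega)
    rintro _ ⟨f, rfl, hf1, hf7⟩
    obtain ⟨hsize, hsource, hone, hinput, -, -, hdrawn⟩ := hin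
    have hAi := hA ⟨i, hi⟩
    have hcard := card_filter_lt_succ (fun j : Fin n => A j = 0 ∧
      side (dist (B j).center (ctr B q)) (B j).radius R = 2) ⟨i, hi⟩
    dsimp only at hcard hAi
    rw [hcard]
    have hcases := side_cases (dist (B ⟨i, hi⟩).center (ctr B q)) (B ⟨i, hi⟩).radius R
    generalize side (dist (B ⟨i, hi⟩).center (ctr B q)) (B ⟨i, hi⟩).radius R = c at *
    refine Runs.seq (T := 1) (T' := 10) (Q' := fun s' => s' = Instr.eval ω (.natLoad 5 0 3) _)
      (Runs.instr rfl) ?_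
    rintro _ rfl
    refine Runs.seq (T := 6) (T' := 4) (Q' := fun s' => ∃ m : ℕ → ℕ,
      s' = { s₁ with realReg := f, natReg := m } ∧
      (∀ r, r ≠ 4 → r ≠ 5 → r ≠ 6 → m r = s₁.natReg r) ∧
      m 6 = s₁.natReg 6 + 3 * if A ⟨i, hi⟩ = 0 ∧ c = 2 then 1 else 0) ?_ ?_
    · refine Runs.ite (T := 5) (fun hb => Runs.ite (T := 4)
        (fun hb' => Runs.block ⟨_, rfl, fun r h1 h2 h3 => ?_, ?_⟩)
        (fun hb' => (Runs.skip ⟨_, rfl, fun r h1 h2 h3 => ?_, ?_⟩).mono (fun _ h => h) (by norm_num)))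
        (fun hb => (Runs.skip ⟨_, rfl, fun r h1 h2 h3 => ?_, ?_⟩).mono (fun _ h => h) (by norm_num))
      all_goals
        simp [Test.holds, Instr.eval, State.setNat, Function.update_apply, hone, harr, hc3, hAi]
          at *
      all_goals first | simp [*]; done | skip
      all_goals rcases hcases with rfl | rfl | rfl <;> simp_all
    · rintro _ ⟨m, rfl, hm, hm6⟩
      refine Runs.block ?_
      simp only [List.foldl, Instr.eval, State.setNat, Function.update_apply]
      refine ⟨⟨?_, ?_, ?_, hinput, hf1, hf7, hdrawn⟩, harr, ?_, ?_, ?_⟩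
      · simpa [hm] using hsize
      · simpa [hm] using hsource
      · simpa [hm] using hone
      · simpa [hm] using hc3
      · norm_num only [if_false]
        rw [hm6, hc6, mul_add]
      · norm_num [hm, hc7]
        omega

theorem runs_updateProgram (ω : RandomTape) {q k : ℕ} {R : ℝ} (hR : 0 ≤ R) {s : State}
    (hs : InRound B q (R ^ 2) k s) {A : Fin n → ℕ} (hA : ∀ i : Fin n, s.natArr 0 i = A i)
    (h3 : s.natReg 3 = 0) :
    Runs ω (updateProgram d) s (fun s' => InRound B q (R ^ 2) k s' ∧
      ∀ i : Fin n, s'.natArr 0 i = if A i = 0 then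
        side (dist (B i).center (ctr B q)) (B i).radius R else A i) (n * (6 * d + 27) + 1) := by
  have key := Runs.forLoop (ω := ω) (s := s) (n := n) (i₀ := 3) (i₁ := 0) (T := 6 * d + 26)
    (I := fun i s' => InRound B q (R ^ 2) k s' ∧ s'.natReg 3 = i ∧
      ∀ j : Fin n, s'.natArr 0 j = if (j : ℕ) < i ∧ A j = 0 then
        side (dist (B j).center (ctr B q)) (B j).radius R else A j)
    (P := .seq (sideProgram d) (.seq (.instr (.natLoad 5 0 3)) (.seq
      (.ite (.natLt 5 8) (.instr (.natStore 0 3 4)) .skip) (.instr (.natSucc 3 3)))))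
    (fun i s' h => ⟨h.2.1, h.1.size⟩) ?_ ⟨hs, h3, by simpa using hA⟩
  · exact key.mono (fun s' h => ⟨h.1, by simpa using h.2.2⟩) le_rfl
  · intro i hi s₁ h
    obtain ⟨hin, hc3, harr⟩ := h
    refine (Runs.seq (runs_sideProgram B ω hR hin (i := ⟨i, hi⟩) hc3) (T' := 4) ?_).mono
      (fun _ h => h) (by omega)
    rintro _ ⟨f, rfl, hf1, hf7⟩
    obtain ⟨hsize, hsource, hone, hinput, -, -, hdrawn⟩ := hin
    have hi' : s₁.natArr 0 i = A ⟨i, hi⟩ := by simpa using harr ⟨i, hi⟩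
    refine Runs.seq (T := 1) (T' := 3) (Q' := fun s' => s' = Instr.eval ω (.natLoad 5 0 3) _)
      (Runs.instr rfl) ?_
    rintro _ rfl
    refine Runs.seq (T := 2) (T' := 1) (Q' := fun s' => ∃ (m : ℕ → ℕ) (a : ℕ → ℕ → ℕ),
      s' = { s₁ with realReg := f, natReg := m, natArr := a } ∧
      (∀ r, r ≠ 4 → r ≠ 5 → m r = s₁.natReg r) ∧
      ∀ j : Fin n, a 0 j = if (j : ℕ) < i + 1 ∧ A j = 0 then
        side (dist (B j).center (ctr B q)) (B j).radius R else A j) ?_ ?_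
    · refine Runs.ite (T := 1)
        (fun hb => Runs.instr ⟨_, _, rfl, fun r h1 h2 => ?_, fun j => ?_⟩)
        (fun hb => Runs.skip ⟨_, _, rfl, fun r h1 h2 => ?_, fun j => ?_⟩)
      · simp [Instr.eval, State.setNat, h1, h2]
      · simp [Test.holds, Instr.eval, State.setNat, Function.update_apply, hone,
          hc3, hi'] at hb ⊢
        by_cases hj : (j : ℕ) = i
        · obtain rfl : j = ⟨i, hi⟩ := Fin.ext hj
          simp [hb]
        · have : (j : ℕ) ≤ i ↔ (j : ℕ) < i := by omega
          simp only [if_neg hj, harr j, this]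
      · simp [h1, h2]
      · simp [Test.holds, Instr.eval, State.setNat, hone, hc3, hi'] at hb ⊢
        by_cases hj : (j : ℕ) = i
        · obtain rfl : j = ⟨i, hi⟩ := Fin.ext hj
          simp [hb, hi']
        · have : (j : ℕ) ≤ i ↔ (j : ℕ) < i := by omega
          simp only [harr j, this]
    · rintro _ ⟨m, a, rfl, hm, ha⟩
      refine Runs.instr ?_
      simp only [Instr.eval, State.setNat, Function.update_apply]
      refine ⟨⟨?_, ?_, ?_, ?_, ?_, ?_, ?_⟩, ?_, ha⟩ <;> norm_num <;> simp [*]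

/-- The state between two rounds, with the labels `A` and after `k` random draws. -/
structure HasLabels (A : Fin n → ℕ) (k : ℕ) (s : State) : Prop where
  size : s.natReg 0 = n
  input : s.realArr = (inputState B).realArr
  labels : ∀ i : Fin n, s.natArr 0 i = A i
  drawn : s.drawn = k

theorem runs_roundProgram (ω : RandomTape) {A : Fin n → ℕ} {k : ℕ} {s : State}
    (hs : HasLabels B A k s) :
    Runs ω (roundProgram d) s (HasLabels B (relabel A
      (sides B (drawIndex n (ω k)) (drawIndex n (ω (k + 1))) (ω (k + 2)))) (k + 3))
      ((12 * d + 60) * (n + 1)) := by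
  obtain ⟨hsize, hinput, hlab, rfl⟩ := hs
  set q := drawIndex n (ω s.drawn) with hq
  set q' := drawIndex n (ω (s.drawn + 1)) with hq'
  set r := dist (ctr B q) (ctr B q') with hr
  set R := sphereRadius r (ω (s.drawn + 2)) with hRdef
  have hR : 0 ≤ R := dist_nonneg.trans (le_sphereRadius dist_nonneg _)
  refine Runs.mono (T := 6 + ((6 * d + 1) + (9 + ((n * (6 * d + 27) + 1) +
    ((1 + (n * (6 * d + 27) + 1)) + 1))))) ?_ (fun _ h => h) (by ring_nf; omega)
  refine Runs.seq (Q' := fun s' => ∃ f m, s' = { s with realReg := f, natReg := m, drawn := s.drawn + 3 } ∧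
    m 0 = n ∧ m 1 = q ∧ m 2 = q' ∧ m 8 = 1 ∧ f 1 = ω (s.drawn + 2) ∧ f 7 = 0)
    (Runs.block ?_) ?_
  · refine ⟨_, _, rfl, ?_⟩
    simp [Instr.eval, State.setNat, State.setReal, State.advance, hsize, hq, hq', drawIndex]
  rintro _ ⟨f, m, rfl, hm0, hm1, hm2, hm8, hf1, hf7⟩
  refine Runs.seq (runs_sqDistProgram ω (by norm_num) (by norm_num) d _) ?_
  rintro _ ⟨f', rfl, hf0', hf'⟩
  dsimp only at hf0' hf' ⊢
  rw [hinput, hm1, hm2, sum_sq_sub_input] at hf0'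
  have hf1' : f' 1 = ω (s.drawn + 2) := (hf' 1 (by norm_num) (by norm_num) (by norm_num)).trans hf1
  have hf7' : f' 7 = 0 := (hf' 7 (by norm_num) (by norm_num) (by norm_num)).trans hf7
  refine Runs.seq (Q' := fun s' => InRound B q (R ^ 2) (s.drawn + 3) s' ∧ s'.natArr = s.natArr ∧
    s'.natReg 3 = 0 ∧ s'.natReg 6 = 0 ∧ s'.natReg 7 = 0) (Runs.block ?_) ?_
  · simp only [List.foldl, Instr.eval, State.setNat, State.setReal, Function.update_apply]
    refine ⟨⟨?_, ?_, ?_, ?_, ?_, ?_, ?_⟩, ?_, ?_, ?_, ?_⟩ <;> norm_num <;>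
      simp only [hm0, hm1, hm8, hinput, hf7', hf1', hf0']
    rw [hRdef, sphereRadius_sq]
    ring
  rintro s₁ ⟨hin, harr, h3, h6, h7⟩
  refine Runs.seq (runs_countProgram B ω hR hin (A := A) (fun i => harr ▸ hlab i) h3 h6 h7) ?_
  rintro s₂ ⟨hin₂, harr₂, h6₂, h7₂⟩
  have hlab₂ : ∀ i : Fin n, s₂.natArr 0 i = A i := fun i => by rw [harr₂, harr, hlab]
  refine Runs.ite (fun hb => (Runs.skip ?_).mono (fun _ h => h) (by omega)) fun hb => ?_
  · simp only [Test.holds, h6₂, h7₂] at hb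
    refine ⟨hin₂.size, hin₂.input, fun i => ?_, hin₂.drawn⟩
    have hb' : ¬ 3 * (Finset.univ.filter fun i => A i = 0 ∧
      sides B q q' (ω (s.drawn + 2)) i = 2).card ≤ 2 * n := not_le.2 hb
    rw [relabel, if_neg hb', hlab₂]
  · simp only [Test.holds, h6₂, h7₂, not_lt] at hb
    refine Runs.seq (Q' := fun s' => InRound B q (R ^ 2) (s.drawn + 3) s' ∧
      (∀ i : Fin n, s'.natArr 0 i = A i) ∧ s'.natReg 3 = 0) (Runs.instr ?_) ?_
    · obtain ⟨h1, h2, h3, h4, h5, h6, h7⟩ := hin₂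
      refine ⟨⟨?_, ?_, ?_, h4, h5, h6, h7⟩, hlab₂, ?_⟩ <;> simp [Instr.eval, State.setNat, *]
    · rintro s₃ ⟨hin₃, hlab₃, h3₃⟩
      refine (runs_updateProgram B ω hR hin₃ hlab₃ h3₃).mono (fun s' h => ?_) le_rfl
      refine ⟨h.1.size, h.1.input, fun i => ?_, h.1.drawn⟩
      have hb' : 3 * (Finset.univ.filter fun i => A i = 0 ∧
        sides B q q' (ω (s.drawn + 2)) i = 2).card ≤ 2 * n := hb
      rw [relabel, if_pos hb']
      exact h.2 i

theorem runs_separatorProgram (ω : RandomTape) (k : ℕ) :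
    Runs ω (separatorProgram d k) (inputState B) (HasLabels B (labels B ω k) (3 * k))
      (k * ((12 * d + 60) * (n + 1)) + 1) := by
  induction k with
  | zero =>
    refine (Runs.skip ⟨?_, rfl, fun i => rfl, rfl⟩).mono (fun _ h => h) (by omega)
    simp [inputState]
  | succ k ih =>
    refine (Runs.seq ih fun s hs => runs_roundProgram B ω hs).mono (fun _ h => h) ?_
    rw [add_mul k 1]
    omega

end Correctness
end BallSeparator


theorem theorem5p1 (d : ℕ) (hd : 2 ≤ d) :
    ∃ (P : BallSeparator.Program) (C : ℝ) (T : ℕ),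
      ∀ (n : ℕ) (B : Fin n → BallSeparator.EuclideanBall d),
        (∀ ω : BallSeparator.RandomTape, ∃ (s : BallSeparator.State) (t : ℕ),
          BallSeparator.Exec ω P (BallSeparator.inputState B) s t ∧ t ≤ T * (n + 1)) ∧
        (1 / 2 : ENNReal) ≤ BallSeparator.tapeMeasure
          {ω | ∃ (s : BallSeparator.State) (t : ℕ),
            BallSeparator.Exec ω P (BallSeparator.inputState B) s t ∧
            BallSeparator.IsBalancedSeparator (BallSeparator.intersectionGraph B)
              (BallSeparator.outputSet n s) ∧
            ((BallSeparator.outputSet n s).ncard : ℝ) ≤ C * BallSeparator.separatorBound B} := by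
  obtain ⟨K, hK0, hK⟩ := BallSeparator.exists_cover d
  refine ⟨BallSeparator.separatorProgram d (27 * K ^ 3), 48 * (27 * K ^ 3 : ℕ),
    27 * K ^ 3 * (12 * d + 60) + 1, fun n B => ⟨fun ω => ?_, ?_⟩⟩
  · obtain ⟨s, t, he, ht, -⟩ := BallSeparator.runs_separatorProgram B ω (27 * K ^ 3)
    refine ⟨s, t, he, ht.trans ?_⟩
    rw [← mul_assoc, add_mul _ 1]
    omega
  · have hsub : {ω | 3 * (Finset.univ.filter fun i =>
          BallSeparator.labels B ω (27 * K ^ 3) i = 0).card ≤ 2 * n ∧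
        ((Finset.univ.filter fun i => BallSeparator.labels B ω (27 * K ^ 3) i = 1).card : ℝ) ≤
          48 * (27 * K ^ 3 : ℕ) * BallSeparator.separatorBound B} ⊆
        {ω | ∃ (s : BallSeparator.State) (t : ℕ),
          BallSeparator.Exec ω (BallSeparator.separatorProgram d (27 * K ^ 3))
            (BallSeparator.inputState B) s t ∧
          BallSeparator.IsBalancedSeparator (BallSeparator.intersectionGraph B)
            (BallSeparator.outputSet n s) ∧
          ((BallSeparator.outputSet n s).ncard : ℝ) ≤
            48 * (27 * K ^ 3 : ℕ) * BallSeparator.separatorBound B} := by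
      rintro ω ⟨hact, hsize⟩
      obtain ⟨s, t, he, -, hs⟩ := BallSeparator.runs_separatorProgram B ω (27 * K ^ 3)
      have hout : BallSeparator.outputSet n s =
          {i | BallSeparator.labels B ω (27 * K ^ 3) i = 1} := by
        ext i
        exact iff_of_eq (congrArg (· = 1) (hs.labels i))
      refine ⟨s, t, he, ?_, ?_⟩
      · rw [hout]
        exact (BallSeparator.isSeparating_labels B ω _).isBalancedSeparator B hact
      · rw [hout]
        convert hsize
        rw [← Set.ncard_coe_finset, Finset.coe_filter_univ]
    rcases n.eq_zero_or_pos with rfl | hn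
    · refine le_trans ?_ (MeasureTheory.measure_mono hsub)
      have huniv : ∀ S : Set BallSeparator.RandomTape, (∀ ω, ω ∈ S) →
          (1 / 2 : ENNReal) ≤ BallSeparator.tapeMeasure S := fun S hS => by
        rw [Set.eq_univ_of_forall hS, MeasureTheory.measure_univ]
        exact ENNReal.half_le_self
      refine huniv _ fun ω => ⟨by simp, ?_⟩
      have := BallSeparator.separatorBound_nonneg B
      simp only [Finset.univ_eq_empty, Finset.filter_empty, Finset.card_empty, Nat.cast_zero]
      positivity
    · exact (BallSeparator.half_le_measure_labels B hd hK0 hK hn).trans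
        (MeasureTheory.measure_mono hsub)
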